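/- Let $n\ge 3$, let $M$ be a smooth $n$-dimensional manifold, let $\alpha=\sqrt{a_{ij}(x)y^iy^j}$ be a smooth Riemannian metric on $M$ and let $\beta=b_i(x)y^i$ be a smooth, nowhere vanishing $1$-form on $M$. Write $b=b(x)=\|\beta\|_\alpha>0$ for the pointwise norm of $\beta$ with respect to $\alpha$, and let $$F=\frac{(b\alpha+\beta)^2}{\alpha}$$ be the associated singular square metric. In local coordinates let $b_{i|j}$ be the covariant derivative of $\beta$ with respect to the Levi-Civita connection of $\alpha$, $b^i=a^{ij}b_j$, where $(a^{ij})=(a_{ij})^{-1}$, and $$r_{ij}=\tfrac12(b_{i|j}+b_{j|i}),\qquad s_{ij}=\tfrac12(b_{i|j}-b_{j|i}),\qquad s_i=b^js_{ji}.$$ Call $F$ a Douglas metric if its Douglas curvature $$D_j{}^i{}_{kl}=\frac{\partial^3}{\partial y^j\partial y^k\partial y^l}\Big(G^i-\frac1{n+1}\frac{\partial G^m}{\partial y^m}\,y^i\Big),\qquad G^i=\tfrac14g^{il}\big\{[F^2]_{x^ky^l}y^k-[F^2]_{x^l}\big\},\quad g_{ij}=\tfrac12[F^2]_{y^iy^j},$$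 vanishes, in all local coordinates, at every nonzero tangent vector where it is defined, that is, where $(g_{ij})$ is invertible. Then $F$ is a Douglas metric if and only if there are smooth functions $c,d$ on $M$ such that, in all local coordinates, $$r_{ij}=c(x)\,a_{ij}+d(x)\,b_ib_j-\frac{3}{b^2}(s_ib_j+s_jb_i),\qquad s_{ij}=\frac1{b^2}(b_is_j-b_js_i).$$ -/

import Mathlib

open scoped Manifold ContDiff Topology Bundle

noncomputable section

namespace SingularSquare

/-- The coordinate space `ℝⁿ`. -/
abbrev Coord (n : ℕ) := EuclideanSpace ℝ (Fin n)

/-- The `i`-th partial derivative of a function on `ℝⁿ`. -/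
def pd {n : ℕ} (i : Fin n) (f : Coord n → ℝ) (u : Coord n) : ℝ :=
  fderiv ℝ f u (EuclideanSpace.single i 1)

/-! ### Finsler geometry in natural coordinates `(u, y)` of the tangent bundle

Here `L u y` stands for the coordinate expression of a function `F` on the tangent bundle. -/

section Finsler

variable {n : ℕ} (L : Coord n → Coord n → ℝ)

/-- The fundamental tensor `g_ij = [F²/2]_{y^i y^j}`. -/
def fundamentalTensor (u y : Coord n) : Matrix (Fin n) (Fin n) ℝ :=
  Matrix.of fun i j => pd i (fun y' => pd j (fun y'' => L u y'' ^ 2 / 2) y') y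

/-- The spray coefficients `G^i = (1/4) g^{il} ([F²]_{x^k y^l} y^k - [F²]_{x^l})`. -/
def spray (i : Fin n) (u y : Coord n) : ℝ :=
  (1 / 4) * ∑ l, (fundamentalTensor L u y)⁻¹ i l *
    ((∑ k, pd k (fun u' => pd l (fun y' => L u' y' ^ 2) y) u * y k)
      - pd l (fun u' => L u' y ^ 2) u)

/-- The Douglas curvature
`D_j^i_kl = ∂³/∂y^j∂y^k∂y^l (G^i - (1/(n+1)) (∂G^m/∂y^m) y^i)`. -/
def douglasCurvature (i j k l : Fin n) (u y : Coord n) : ℝ :=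
  pd j (fun y₁ => pd k (fun y₂ => pd l (fun y₃ =>
    spray L i u y₃ - (1 / ((n : ℝ) + 1)) * (∑ m, pd m (fun y₄ => spray L m u y₄) y₃) * y₃ i)
      y₂) y₁) y

end Finsler

/-! ### A Riemannian metric `a_ij` and a `1`-form `b_i` in local coordinates -/

section Local

variable {n : ℕ} (a : Coord n → Matrix (Fin n) (Fin n) ℝ) (b : Coord n → Fin n → ℝ)

/-- The Christoffel symbols
`γ^k_ij = (1/2) a^{kl} (∂_i a_lj + ∂_j a_li - ∂_l a_ij)`. -/
def christoffel (k i j : Fin n) (u : Coord n) : ℝ :=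
  (1 / 2) * ∑ l, (a u)⁻¹ k l *
    (pd i (fun u' => a u' l j) u + pd j (fun u' => a u' l i) u - pd l (fun u' => a u' i j) u)

/-- The covariant derivative `b_{i|j} = ∂_j b_i - γ^k_ij b_k`. -/
def covDeriv (i j : Fin n) (u : Coord n) : ℝ :=
  pd j (fun u' => b u' i) u - ∑ k, christoffel a k i j u * b u k

/-- `r_ij = (b_{i|j} + b_{j|i}) / 2`. -/
def rTensor (i j : Fin n) (u : Coord n) : ℝ :=
  (1 / 2) * (covDeriv a b i j u + covDeriv a b j i u)

/-- `s_ij = (b_{i|j} - b_{j|i}) / 2`. -/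
def sTensor (i j : Fin n) (u : Coord n) : ℝ :=
  (1 / 2) * (covDeriv a b i j u - covDeriv a b j i u)

/-- `b^i = a^{ij} b_j`. -/
def raised (i : Fin n) (u : Coord n) : ℝ :=
  ∑ j, (a u)⁻¹ i j * b u j

/-- `s_i = b^j s_ji`. -/
def sForm (i : Fin n) (u : Coord n) : ℝ :=
  ∑ j, raised a b j u * sTensor a b j i u

/-- The two equations, at the point `u`, for `N = ‖β‖_α` and the values `c`, `d` at `u`:
`r_ij = c a_ij + d b_i b_j - (3/N²) (s_i b_j + s_j b_i)` and
`s_ij = (1/N²) (b_i s_j - b_j s_i)`. -/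
def StructureEquations (N c d : ℝ) (u : Coord n) : Prop :=
  ∀ i j : Fin n,
    rTensor a b i j u = c * a u i j + d * b u i * b u j
        - 3 / N ^ 2 * (sForm a b i u * b u j + sForm a b j u * b u i) ∧
      sTensor a b i j u = 1 / N ^ 2 * (b u i * sForm a b j u - b u j * sForm a b i u)

end Local

/-! ### Objects on a manifold -/

section Manifold

variable {n : ℕ} {M : Type*} [TopologicalSpace M] [ChartedSpace (Coord n) M]

/-- The tangent vector at `e.symm u` with components `y` in the coordinate system `e`,
that is `∑ y^i ∂/∂x^i`. -/
def coordVector (e : OpenPartialHomeomorph M (Coord n)) (u y : Coord n) :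
    TangentSpace (𝓡 n) (e.symm u) :=
  mfderiv 𝓘(ℝ, Coord n) (𝓡 n) e.symm u y

/-- The expression in the natural coordinates `(u, y)` of a function on the tangent bundle. -/
def localExpr (F : (x : M) → TangentSpace (𝓡 n) x → ℝ)
    (e : OpenPartialHomeomorph M (Coord n)) (u y : Coord n) : ℝ :=
  F (e.symm u) (coordVector e u y)

/-- `F` is a Douglas metric: in every local coordinate system its Douglas curvature vanishes
at all nonzero tangent vectors at which the fundamental tensor is nondegenerate (the vectors at
which the spray, hence the Douglas curvature, is defined). For a regular Finsler metric these are
all the nonzero tangent vectors. -/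
def IsDouglas (F : (x : M) → TangentSpace (𝓡 n) x → ℝ) : Prop :=
  ∀ e ∈ IsManifold.maximalAtlas (𝓡 n) ∞ M, ∀ u ∈ e.target, ∀ y : Coord n, y ≠ 0 →
    (fundamentalTensor (localExpr F e) u y).det ≠ 0 →
      ∀ i j k l : Fin n, douglasCurvature (localExpr F e) i j k l u y = 0

/-- A `1`-form, as a section of the cotangent bundle, is smooth. -/
def IsSmoothForm [IsManifold (𝓡 n) ∞ M] (β : (x : M) → TangentSpace (𝓡 n) x →L[ℝ] ℝ) : Prop :=
  ContMDiff (𝓡 n) ((𝓡 n).prod 𝓘(ℝ, Coord n →L[ℝ] ℝ)) ∞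
    (fun x => Bundle.TotalSpace.mk' (Coord n →L[ℝ] ℝ)
      (E := fun x : M => TangentSpace (𝓡 n) x →L[ℝ] ℝ) x (β x))

variable [IsManifold (𝓡 n) ∞ M]
  (g : Bundle.ContMDiffRiemannianMetric (𝓡 n) ∞ (Coord n) (fun x : M => TangentSpace (𝓡 n) x))
  (β : (x : M) → TangentSpace (𝓡 n) x →L[ℝ] ℝ)

/-- `α(x, v) = √(a_x(v, v))`. -/
def alpha (x : M) (v : TangentSpace (𝓡 n) x) : ℝ := Real.sqrt (g.inner x v v)

/-- `b(x) = ‖β‖_α`, the norm of the linear form `β_x` with respect to the inner product `a_x`. -/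
def formNorm (x : M) : ℝ :=
  sSup {t : ℝ | ∃ v : TangentSpace (𝓡 n) x, alpha g x v ≤ 1 ∧ t = |β x v|}

/-- The function `F = (b α + β)² / α` on the tangent bundle. -/
def singularSquareMetric (x : M) (v : TangentSpace (𝓡 n) x) : ℝ :=
  (formNorm g β x * alpha g x v + β x v) ^ 2 / alpha g x v

/-- The components `a_ij` of the Riemannian metric in the coordinate system `e`. -/
def metricCoeff (e : OpenPartialHomeomorph M (Coord n)) (u : Coord n) :
    Matrix (Fin n) (Fin n) ℝ :=
  Matrix.of fun i j => g.inner (e.symm u)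
    (coordVector e u (EuclideanSpace.single i 1)) (coordVector e u (EuclideanSpace.single j 1))

/-- The components `b_i` of the `1`-form in the coordinate system `e`. -/
def formCoeff (e : OpenPartialHomeomorph M (Coord n)) (u : Coord n) (i : Fin n) : ℝ :=
  β (e.symm u) (coordVector e u (EuclideanSpace.single i 1))

end Manifold

end SingularSquare

end

/-! Write A = α², C = bα - β, D = bα + β, and let Q be the difference of the sprays of F and α. F²
is a function of b, A and β, so the Euler-Lagrange equations paired with y and with b^i form a
closed linear system for a(y, Q) and β(Q). Solving it gives Q in closed form where CD ≠ 0
(`solve_contracted`, `bilin_deviation`). As n ≥ 3, CD ≠ 0 is also exactly the invertibility of g_ij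
(`det_ne_zero_iff`), so the formula covers every vector at which the Douglas curvature is tested.

Sufficiency: under the structure equations the denominators cancel, and Q is a multiple (constant ·
α + linear) of y plus α² times a fixed vector (`deviation_of_structureEquations`). The trace
correction in the Douglas curvature removes the term α y; quadratic polynomials remain, and three
derivatives kill them (`third_pd_projective_eq_zero`).

Necessity: if the Douglas curvature vanishes, then along a line y + tz of regular vectors a(w, Q) is
quadratic in t for every w orthogonal to y and z (`deviation_quadratic_along_line`). Two families of
lines suffice. On v + t b^i with v orthogonal to b^i the formula for Q contains √(k + l t²), which
is not rational in t. Hence s_ij vanishes on the orthogonal complement of b^i, and the derivative of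
b there is determined by s_i (`sMat_orthogonal_of_douglas`). Since b b_{|j} = b^i b_{i|j} always
holds (`norm_mul_fderiv`), this determines r_ij b^i up to the scalar r_ij b^i b^j. On b^i + e + tf,
with e, f orthonormal and orthogonal to b^i, the root drops out, and divisibility by 1 + t² makes
r_ij proportional to a_ij on that complement (`rMat_orthonormal_of_douglas`).

Globally, c and d are rational expressions in traces of r_ij, hence smooth in each chart
(`eq_coeff`). As r_ij is a tensor, they do not depend on the chart (`structureEquations_unique`). -/

noncomputable section
namespace SingularSquare

/-! ### Derivatives of F² in the variables b, A = α² and β -/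

section

/-- `F²` as a function of the norm `m` of the form, of `A = α²` and of `β`. -/
def energy (m A β : ℝ) : ℝ := (m * √A + β) ^ 4 / A
/-- The derivative of `energy` with respect to `A`. -/
def energyA (m A β : ℝ) : ℝ := (m * √A + β) ^ 3 * (m * √A - β) / A ^ 2
/-- The derivative of `energy` with respect to `β`. -/
def energyB (m A β : ℝ) : ℝ := 4 * (m * √A + β) ^ 3 / A
/-- The derivative of `energy` with respect to `m`. -/
def energyM (m A β : ℝ) : ℝ := 4 * (m * √A + β) ^ 3 / √A
-- The suffixes name the variables of differentiation. A second derivative in m is not needed: m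
-- depends on the base point only, and the spray takes at most one derivative there.
def energyAA (m A β : ℝ) : ℝ := (m * √A + β) ^ 2 * β * (2 * β - m * √A) / A ^ 3
def energyAB (m A β : ℝ) : ℝ := 2 * (m * √A + β) ^ 2 * (m * √A - 2 * β) / A ^ 2
def energyAM (m A β : ℝ) : ℝ := (m * √A + β) ^ 2 * (4 * m * √A - 2 * β) / (A * √A)
def energyBB (m A β : ℝ) : ℝ := 12 * (m * √A + β) ^ 2 / A
def energyBM (m A β : ℝ) : ℝ := 12 * (m * √A + β) ^ 2 / √A

section
variable {X : Type*} [NormedAddCommGroup X] [NormedSpace ℝ X] {m A β : X → ℝ}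
  {m' A' β' : X →L[ℝ] ℝ} {x : X}

theorem hasFDerivAt_energy (hm : HasFDerivAt m m' x) (hA : HasFDerivAt A A' x)
    (hβ : HasFDerivAt β β' x) (h0 : 0 < A x) :
    HasFDerivAt (fun z => energy (m z) (A z) (β z))
      (energyM (m x) (A x) (β x) • m' + energyA (m x) (A x) (β x) • A'
        + energyB (m x) (A x) (β x) • β') x := by
  have hS := hA.sqrt h0.ne'
  have hD := (hm.mul hS).add hβ
  have hI := (hasDerivAt_inv h0.ne').comp_hasFDerivAt x hA
  have hE := (hD.pow 4).mul hI
  refine (hE.congr_fderiv ?_)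
  ext v
  have hs : 0 < √(A x) := Real.sqrt_pos.2 h0
  have h2 : A x = √(A x) ^ 2 := (Real.sq_sqrt h0.le).symm
  simp [energyM, energyA, energyB]
  generalize √(A x) = s at *
  rw [h2]
  field_simp
  ring

theorem hasFDerivAt_energyA (hm : HasFDerivAt m m' x) (hA : HasFDerivAt A A' x)
    (hβ : HasFDerivAt β β' x) (h0 : 0 < A x) :
    HasFDerivAt (fun z => energyA (m z) (A z) (β z))
      (energyAM (m x) (A x) (β x) • m' + energyAA (m x) (A x) (β x) • A'
        + energyAB (m x) (A x) (β x) • β') x := by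
  have hS := hA.sqrt h0.ne'
  have hD := (hm.mul hS).add hβ
  have hC := (hm.mul hS).sub hβ
  have hI := (hasDerivAt_inv (pow_pos h0 2).ne').comp_hasFDerivAt x (hA.pow 2)
  have hE := ((hD.pow 3).mul hC).mul hI
  refine (hE.congr_fderiv ?_)
  ext v
  have hs : 0 < √(A x) := Real.sqrt_pos.2 h0
  have h2 : A x = √(A x) ^ 2 := (Real.sq_sqrt h0.le).symm
  simp [energyAM, energyAA, energyAB]
  generalize √(A x) = s at *
  rw [h2]
  field_simp
  ring

theorem hasFDerivAt_energyB (hm : HasFDerivAt m m' x) (hA : HasFDerivAt A A' x)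
    (hβ : HasFDerivAt β β' x) (h0 : 0 < A x) :
    HasFDerivAt (fun z => energyB (m z) (A z) (β z))
      (energyBM (m x) (A x) (β x) • m' + energyAB (m x) (A x) (β x) • A'
        + energyBB (m x) (A x) (β x) • β') x := by
  have hS := hA.sqrt h0.ne'
  have hD := (hm.mul hS).add hβ
  have hI := (hasDerivAt_inv h0.ne').comp_hasFDerivAt x hA
  have hE := ((hD.pow 3).const_mul 4).mul hI
  refine (hE.congr_fderiv ?_)
  ext v
  have hs : 0 < √(A x) := Real.sqrt_pos.2 h0
  have h2 : A x = √(A x) ^ 2 := (Real.sq_sqrt h0.le).symm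
  simp [energyBM, energyBB, energyAB]
  generalize √(A x) = s at *
  rw [h2]
  field_simp
  ring

end

/-! ### Bilinear and linear forms given by components -/

variable {n : ℕ}

/-- The bilinear form with a given matrix. -/
def bilin (A : Matrix (Fin n) (Fin n) ℝ) : Coord n →ₗ[ℝ] Coord n →ₗ[ℝ] ℝ :=
  LinearMap.mk₂ ℝ (fun v w => ∑ i, ∑ j, A i j * v i * w j)
    (by
      intros
      simp only [PiLp.add_apply, ← Finset.sum_add_distrib]
      exact Finset.sum_congr rfl fun i _ => Finset.sum_congr rfl fun j _ => by ring)
    (by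
      intros
      simp only [PiLp.smul_apply, smul_eq_mul, Finset.mul_sum]
      exact Finset.sum_congr rfl fun i _ => Finset.sum_congr rfl fun j _ => by ring)
    (by
      intros
      simp only [PiLp.add_apply, ← Finset.sum_add_distrib]
      exact Finset.sum_congr rfl fun i _ => Finset.sum_congr rfl fun j _ => by ring)
    (by
      intros
      simp only [PiLp.smul_apply, smul_eq_mul, Finset.mul_sum]
      exact Finset.sum_congr rfl fun i _ => Finset.sum_congr rfl fun j _ => by ring)

theorem bilin_apply (A : Matrix (Fin n) (Fin n) ℝ) (v w : Coord n) :
    bilin A v w = ∑ i, ∑ j, A i j * v i * w j := rfl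

/-- The linear form with given coefficients. -/
def lin (β : Fin n → ℝ) : Coord n →ₗ[ℝ] ℝ where
  toFun v := ∑ i, β i * v i
  map_add' := by intros; simp only [PiLp.add_apply, mul_add, Finset.sum_add_distrib]
  map_smul' := by
    intros; simp only [PiLp.smul_apply, smul_eq_mul, Finset.mul_sum, RingHom.id_apply]
    exact Finset.sum_congr rfl fun i _ => by ring

theorem lin_apply (β : Fin n → ℝ) (v : Coord n) : lin β v = ∑ i, β i * v i := rfl

theorem bilin_single (A : Matrix (Fin n) (Fin n) ℝ) (i j : Fin n) :
    bilin A (EuclideanSpace.single i 1) (EuclideanSpace.single j 1) = A i j := by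
  simp [bilin_apply]

theorem lin_single (β : Fin n → ℝ) (i : Fin n) :
    lin β (EuclideanSpace.single i 1) = β i := by
  simp [lin_apply]

theorem bilin_comm {A : Matrix (Fin n) (Fin n) ℝ} (hA : ∀ i j, A i j = A j i) (v w : Coord n) :
    bilin A v w = bilin A w v := by
  rw [bilin_apply, bilin_apply, Finset.sum_comm]
  exact Finset.sum_congr rfl fun i _ => Finset.sum_congr rfl fun j _ => by rw [hA]; ring

theorem sum_smul_single (y : Coord n) : ∑ i, y i • EuclideanSpace.single i (1 : ℝ) = y := by
  ext j; simp [Finset.sum_apply, Pi.single_apply]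

theorem map_eq_sum {E : Type*} [AddCommGroup E] [Module ℝ E] (f : Coord n →ₗ[ℝ] E) (y : Coord n) :
    f y = ∑ i, y i • f (EuclideanSpace.single i 1) := by
  conv_lhs => rw [← sum_smul_single y]
  simp

theorem fderiv_apply_eq_sum (f : Coord n → ℝ) (u w : Coord n) :
    fderiv ℝ f u w = ∑ i, w i * pd i f u := by
  simpa [pd] using map_eq_sum (fderiv ℝ f u : Coord n →ₗ[ℝ] ℝ) w

/-- The directional derivative of a matrix valued function. -/
def dMat (a : Coord n → Matrix (Fin n) (Fin n) ℝ) (u z : Coord n) : Matrix (Fin n) (Fin n) ℝ :=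
  Matrix.of fun i j => fderiv ℝ (fun u' => a u' i j) u z

/-- The directional derivative of a covector valued function. -/
def dVec (b : Coord n → Fin n → ℝ) (u z : Coord n) : Fin n → ℝ :=
  fun i => fderiv ℝ (fun u' => b u' i) u z

theorem hasFDerivAt_bilin {a : Coord n → Matrix (Fin n) (Fin n) ℝ} {u : Coord n}
    (ha : ∀ i j, DifferentiableAt ℝ (fun u' => a u' i j) u) (v w : Coord n) :
    ∃ f' : Coord n →L[ℝ] ℝ, HasFDerivAt (fun u' => bilin (a u') v w) f' u ∧
      ∀ z, f' z = bilin (dMat a u z) v w := by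
  refine ⟨∑ i, ∑ j, (v i * w j) • fderiv ℝ (fun u' => a u' i j) u, ?_, ?_⟩
  · simp only [bilin_apply]
    refine HasFDerivAt.fun_sum fun i _ => HasFDerivAt.fun_sum fun j _ => ?_
    refine (((ha i j).hasFDerivAt.mul_const (v i)).mul_const (w j)).congr_fderiv ?_
    ext z; simp; ring
  · intro z
    simp only [bilin_apply, dMat, Matrix.of_apply, sum_apply]
    exact Finset.sum_congr rfl fun i _ => Finset.sum_congr rfl fun j _ => by simp; ring

theorem hasFDerivAt_lin {b : Coord n → Fin n → ℝ} {u : Coord n}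
    (hb : ∀ i, DifferentiableAt ℝ (fun u' => b u' i) u) (v : Coord n) :
    ∃ f' : Coord n →L[ℝ] ℝ, HasFDerivAt (fun u' => lin (b u') v) f' u ∧
      ∀ z, f' z = lin (dVec b u z) v := by
  refine ⟨∑ i, v i • fderiv ℝ (fun u' => b u' i) u, ?_, ?_⟩
  · simp only [lin_apply]
    refine HasFDerivAt.fun_sum fun i _ => ?_
    refine ((hb i).hasFDerivAt.mul_const (v i)).congr_fderiv ?_
    ext z; simp
  · intro z
    simp only [lin_apply, dVec, sum_apply]
    exact Finset.sum_congr rfl fun i _ => by simp; ring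

theorem hasFDerivAt_lin_right (β : Fin n → ℝ) (y : Coord n) :
    HasFDerivAt (fun y' => lin β y') (lin β).toContinuousLinearMap y :=
  (lin β).toContinuousLinearMap.hasFDerivAt

theorem hasFDerivAt_bilin_self {A : Matrix (Fin n) (Fin n) ℝ} (hA : ∀ i j, A i j = A j i)
    (y : Coord n) : HasFDerivAt (fun y' => bilin A y' y')
      ((2 : ℝ) • (bilin A y).toContinuousLinearMap) y := by
  have h1 : ∀ j, HasFDerivAt (fun y' : Coord n => y' j)
      (EuclideanSpace.proj j : Coord n →L[ℝ] ℝ) y := fun j =>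
    (EuclideanSpace.proj j : Coord n →L[ℝ] ℝ).hasFDerivAt
  have h2 : HasFDerivAt (fun y' => ∑ i, ∑ j, A i j * y' i * y' j) (∑ i, ∑ j,
      ((A i j * y i) • (EuclideanSpace.proj j : Coord n →L[ℝ] ℝ) +
        y j • A i j • (EuclideanSpace.proj i : Coord n →L[ℝ] ℝ))) y :=
    HasFDerivAt.fun_sum fun i _ => HasFDerivAt.fun_sum fun j _ =>
      ((h1 i).const_mul (A i j)).mul (h1 j)
  refine h2.congr_fderiv ?_
  ext w
  have : bilin A w y + bilin A y w = 2 * bilin A y w := by rw [bilin_comm hA w y]; ring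
  rw [smul_apply, LinearMap.coe_toContinuousLinearMap', smul_eq_mul, ← this]
  simp only [bilin_apply, sum_apply, add_apply, smul_apply, PiLp.proj_apply, smul_eq_mul,
    ← Finset.sum_add_distrib]
  exact Finset.sum_congr rfl fun i _ => Finset.sum_congr rfl fun j _ => by ring

end

/-! ### The local model, its fundamental tensor and the Euler-Lagrange equations -/

section

variable {n : ℕ}

/-- The vector `b^i`. -/
def sharp (a : Coord n → Matrix (Fin n) (Fin n) ℝ) (b : Coord n → Fin n → ℝ) (u : Coord n) :
    Coord n := WithLp.toLp 2 fun i => raised a b i u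

/-- The function `L` is the coordinate expression of `(m α + β)² / α` over `U`, where `m` is the
norm of `β` with respect to `α`. -/
structure IsLocalModel (L : Coord n → Coord n → ℝ) (a : Coord n → Matrix (Fin n) (Fin n) ℝ)
    (b : Coord n → Fin n → ℝ) (m : Coord n → ℝ) (U : Set (Coord n)) : Prop where
  isOpen : IsOpen U
  metric_smooth : ∀ i j, ContDiffOn ℝ ∞ (fun u => a u i j) U
  form_smooth : ∀ i, ContDiffOn ℝ ∞ (fun u => b u i) U
  norm_smooth : ContDiffOn ℝ ∞ m U
  metric_symm : ∀ u ∈ U, ∀ i j, a u i j = a u j i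
  metric_pos : ∀ u ∈ U, ∀ y ≠ 0, 0 < bilin (a u) y y
  norm_pos : ∀ u ∈ U, 0 < m u
  norm_sq : ∀ u ∈ U, m u ^ 2 = lin (b u) (sharp a b u)
  eq : ∀ u ∈ U, ∀ y,
    L u y = (m u * √(bilin (a u) y y) + lin (b u) y) ^ 2 / √(bilin (a u) y y)

theorem isUnit_det_of_pos {A : Matrix (Fin n) (Fin n) ℝ}
    (h : ∀ y : Coord n, y ≠ 0 → 0 < bilin A y y) : IsUnit A.det := by
  rw [isUnit_iff_ne_zero]
  intro h0
  obtain ⟨v, hv, hv0⟩ := Matrix.exists_mulVec_eq_zero_iff.2 h0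
  have hne : WithLp.toLp 2 v ≠ 0 := by simpa using hv
  refine (h (WithLp.toLp 2 v) hne).ne' ?_
  have : ∀ i, ∑ j, A i j * v j = 0 := fun i => by
    simpa [Matrix.mulVec, dotProduct] using congrFun hv0 i
  simp only [bilin_apply]
  refine Finset.sum_eq_zero fun i _ => ?_
  simp_rw [mul_right_comm _ (v i), ← Finset.sum_mul, this, zero_mul]

theorem bilin_eq_of_single {M : Matrix (Fin n) (Fin n) ℝ} (B : Coord n →ₗ[ℝ] Coord n →ₗ[ℝ] ℝ)
    (hB : ∀ i j, M i j = B (EuclideanSpace.single i 1) (EuclideanSpace.single j 1))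
    (v w : Coord n) : bilin M v w = B v w := by
  rw [map_eq_sum B v, bilin_apply, LinearMap.sum_apply]
  refine Finset.sum_congr rfl fun i _ => ?_
  rw [LinearMap.smul_apply, map_eq_sum (B _) w, smul_eq_mul, Finset.mul_sum]
  exact Finset.sum_congr rfl fun j _ => by rw [hB, smul_eq_mul]; ring

theorem bilin_eq_sum_mul (A : Matrix (Fin n) (Fin n) ℝ) (v w : Coord n) :
    bilin A v w = ∑ i, v i * ∑ j, A i j * w j := by
  simp only [bilin_apply, Finset.mul_sum]
  exact Finset.sum_congr rfl fun i _ => Finset.sum_congr rfl fun j _ => by ring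

/-- Raising an index is characterised by pairing. Through this identity b^i, the Christoffel symbols
and the spray are handled as solutions of linear equations, without expanding inverse matrices. -/
theorem bilin_inv_mulVec {A : Matrix (Fin n) (Fin n) ℝ} (hA : IsUnit A.det) (c : Fin n → ℝ)
    (w : Coord n) :
    bilin A w (WithLp.toLp 2 fun i => ∑ j, A⁻¹ i j * c j) = lin c w := by
  have h : A.mulVec (A⁻¹.mulVec c) = c := by
    rw [Matrix.mulVec_mulVec, Matrix.mul_nonsing_inv _ hA, Matrix.one_mulVec]
  rw [bilin_eq_sum_mul, lin_apply]
  refine Finset.sum_congr rfl fun i _ => ?_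
  have := congrFun h i
  simp only [Matrix.mulVec, dotProduct] at this
  rw [this, mul_comm]

namespace IsLocalModel
variable {L : Coord n → Coord n → ℝ} {a : Coord n → Matrix (Fin n) (Fin n) ℝ}
  {b : Coord n → Fin n → ℝ} {m : Coord n → ℝ} {U : Set (Coord n)} {u y : Coord n}

theorem mem_nhds (h : IsLocalModel L a b m U) (hu : u ∈ U) : U ∈ 𝓝 u := h.isOpen.mem_nhds hu

theorem metric_diff (h : IsLocalModel L a b m U) (hu : u ∈ U) (i j : Fin n) :
    DifferentiableAt ℝ (fun u => a u i j) u :=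
  ((h.metric_smooth i j).contDiffAt (h.mem_nhds hu)).differentiableAt (by simp)

theorem form_diff (h : IsLocalModel L a b m U) (hu : u ∈ U) (i : Fin n) :
    DifferentiableAt ℝ (fun u => b u i) u :=
  ((h.form_smooth i).contDiffAt (h.mem_nhds hu)).differentiableAt (by simp)

theorem norm_diff (h : IsLocalModel L a b m U) (hu : u ∈ U) : DifferentiableAt ℝ m u :=
  (h.norm_smooth.contDiffAt (h.mem_nhds hu)).differentiableAt (by simp)

theorem bilin_sharp (h : IsLocalModel L a b m U) (hu : u ∈ U) (w : Coord n) :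
    bilin (a u) w (sharp a b u) = lin (b u) w :=
  bilin_inv_mulVec (isUnit_det_of_pos (h.metric_pos u hu)) (b u) w

theorem sq_eq (h : IsLocalModel L a b m U) (hu : u ∈ U) (y : Coord n) :
    L u y ^ 2 = energy (m u) (bilin (a u) y y) (lin (b u) y) := by
  have : 0 ≤ bilin (a u) y y := by
    rcases eq_or_ne y 0 with rfl | hy
    · simp
    · exact (h.metric_pos u hu y hy).le
  rw [h.eq u hu, energy, div_pow, Real.sq_sqrt this, ← pow_mul]

theorem hasFDerivAt_right (h : IsLocalModel L a b m U) (hu : u ∈ U) (hy : y ≠ 0) :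
    HasFDerivAt (fun y' => L u y' ^ 2)
      (energyA (m u) (bilin (a u) y y) (lin (b u) y) •
          ((2 : ℝ) • (bilin (a u) y).toContinuousLinearMap)
        + energyB (m u) (bilin (a u) y y) (lin (b u) y) • (lin (b u)).toContinuousLinearMap) y := by
  rw [funext (h.sq_eq hu)]
  have := hasFDerivAt_energy (hasFDerivAt_const (m u) y)
    (hasFDerivAt_bilin_self (h.metric_symm u hu) y) (hasFDerivAt_lin_right (b u) y)
    (h.metric_pos u hu y hy)
  simpa using this

theorem pd_right (h : IsLocalModel L a b m U) (hu : u ∈ U) (hy : y ≠ 0) (l : Fin n) :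
    pd l (fun y' => L u y' ^ 2) y =
      2 * energyA (m u) (bilin (a u) y y) (lin (b u) y) *
          bilin (a u) y (EuclideanSpace.single l 1)
        + energyB (m u) (bilin (a u) y y) (lin (b u) y) * b u l := by
  rw [pd, (h.hasFDerivAt_right hu hy).fderiv]
  simp [lin_single]
  ring

theorem fundamentalTensor_eq (h : IsLocalModel L a b m U) (hu : u ∈ U) (hy : y ≠ 0) (i l : Fin n) :
    fundamentalTensor L u y i l =
      2 * energyAA (m u) (bilin (a u) y y) (lin (b u) y) *
          bilin (a u) y (EuclideanSpace.single i 1) * bilin (a u) y (EuclideanSpace.single l 1)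
        + energyAB (m u) (bilin (a u) y y) (lin (b u) y) *
          (b u i * bilin (a u) y (EuclideanSpace.single l 1)
            + b u l * bilin (a u) y (EuclideanSpace.single i 1))
        + energyA (m u) (bilin (a u) y y) (lin (b u) y) * a u i l
        + energyBB (m u) (bilin (a u) y y) (lin (b u) y) / 2 * b u i * b u l := by
  have h1 : (fun y' => pd l (fun y'' => L u y'' ^ 2 / 2) y') =ᶠ[𝓝 y] fun y' =>
      energyA (m u) (bilin (a u) y' y') (lin (b u) y') *
          bilin (a u) y' (EuclideanSpace.single l 1)
        + energyB (m u) (bilin (a u) y' y') (lin (b u) y') * (b u l / 2) := by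
    filter_upwards [isOpen_ne.mem_nhds hy] with y' hy'
    have : pd l (fun y'' => L u y'' ^ 2 / 2) y' = pd l (fun y'' => L u y'' ^ 2) y' / 2 := by
      simp_rw [div_eq_mul_inv]
      rw [pd, ((h.hasFDerivAt_right hu hy').mul_const (2 : ℝ)⁻¹).fderiv, pd,
        (h.hasFDerivAt_right hu hy').fderiv, smul_apply, smul_eq_mul, mul_comm]
    rw [this, h.pd_right hu hy']
    ring
  have hA := hasFDerivAt_bilin_self (h.metric_symm u hu) y
  have h0 := h.metric_pos u hu y hy
  have hB := hasFDerivAt_lin_right (b u) y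
  have e1 := hasFDerivAt_energyA (hasFDerivAt_const (m u) y) hA hB h0
  have e2 := hasFDerivAt_energyB (hasFDerivAt_const (m u) y) hA hB h0
  have e3 : HasFDerivAt (fun y' => bilin (a u) y' (EuclideanSpace.single l 1))
      ((bilin (a u)).flip (EuclideanSpace.single l 1)).toContinuousLinearMap y :=
    ((bilin (a u)).flip (EuclideanSpace.single l 1)).toContinuousLinearMap.hasFDerivAt
  rw [fundamentalTensor, Matrix.of_apply, pd, h1.fderiv_eq,
    ((e1.fun_mul e3).fun_add (e2.mul_const (b u l / 2))).fderiv]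
  simp [lin_single, bilin_single]
  ring

/-- Apart from the multiple `energyA` of a_ij, only the two covectors a(y, ·) and β occur. This is
why pairing with y and b^i is enough to invert g_ij. -/
theorem bilin_fundamentalTensor (h : IsLocalModel L a b m U) (hu : u ∈ U) (hy : y ≠ 0)
    (v w : Coord n) :
    bilin (fundamentalTensor L u y) v w =
      2 * energyAA (m u) (bilin (a u) y y) (lin (b u) y) * bilin (a u) y v * bilin (a u) y w
        + energyAB (m u) (bilin (a u) y y) (lin (b u) y) *
          (lin (b u) v * bilin (a u) y w + lin (b u) w * bilin (a u) y v)
        + energyA (m u) (bilin (a u) y y) (lin (b u) y) * bilin (a u) v w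
        + energyBB (m u) (bilin (a u) y y) (lin (b u) y) / 2 * lin (b u) v * lin (b u) w := by
  set f := bilin (a u) y
  set g := lin (b u)
  have := bilin_eq_of_single (M := fundamentalTensor L u y)
    ((2 * energyAA (m u) (bilin (a u) y y) (lin (b u) y)) • f.smulRight f
      + energyAB (m u) (bilin (a u) y y) (lin (b u) y) • (g.smulRight f + f.smulRight g)
      + energyA (m u) (bilin (a u) y y) (lin (b u) y) • bilin (a u)
      + (energyBB (m u) (bilin (a u) y y) (lin (b u) y) / 2) • g.smulRight g) (fun i l => by
        rw [h.fundamentalTensor_eq hu hy]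
        simp [lin_single, bilin_single, f, g]
        ring)
  rw [this]
  simp [f, g]
  ring

theorem eventually_fderiv_right (h : IsLocalModel L a b m U) (hu : u ∈ U) (hy : y ≠ 0)
    (w : Coord n) : (fun u' => fderiv ℝ (fun y' => L u' y' ^ 2) y w) =ᶠ[𝓝 u] fun u' =>
      2 * energyA (m u') (bilin (a u') y y) (lin (b u') y) * bilin (a u') y w
        + energyB (m u') (bilin (a u') y y) (lin (b u') y) * lin (b u') w := by
  filter_upwards [h.mem_nhds hu] with u' hu'
  rw [(h.hasFDerivAt_right hu' hy).fderiv]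
  simp
  ring

theorem hasFDerivAt_fderiv_right (h : IsLocalModel L a b m U) (hu : u ∈ U) (hy : y ≠ 0)
    (w : Coord n) : ∃ f' : Coord n →L[ℝ] ℝ,
      HasFDerivAt (fun u' => fderiv ℝ (fun y' => L u' y' ^ 2) y w) f' u ∧ ∀ z, f' z =
        2 * (energyAM (m u) (bilin (a u) y y) (lin (b u) y) * fderiv ℝ m u z
          + energyAA (m u) (bilin (a u) y y) (lin (b u) y) * bilin (dMat a u z) y y
          + energyAB (m u) (bilin (a u) y y) (lin (b u) y) * lin (dVec b u z) y) * bilin (a u) y w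
        + 2 * energyA (m u) (bilin (a u) y y) (lin (b u) y) * bilin (dMat a u z) y w
        + (energyBM (m u) (bilin (a u) y y) (lin (b u) y) * fderiv ℝ m u z
          + energyAB (m u) (bilin (a u) y y) (lin (b u) y) * bilin (dMat a u z) y y
          + energyBB (m u) (bilin (a u) y y) (lin (b u) y) * lin (dVec b u z) y) * lin (b u) w
        + energyB (m u) (bilin (a u) y y) (lin (b u) y) * lin (dVec b u z) w := by
  obtain ⟨A', hA, hA'⟩ := hasFDerivAt_bilin (h.metric_diff hu) y y
  obtain ⟨C', hC, hC'⟩ := hasFDerivAt_bilin (h.metric_diff hu) y w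
  obtain ⟨B', hB, hB'⟩ := hasFDerivAt_lin (h.form_diff hu) y
  obtain ⟨W', hW, hW'⟩ := hasFDerivAt_lin (h.form_diff hu) w
  have h0 := h.metric_pos u hu y hy
  have e1 := hasFDerivAt_energyA (h.norm_diff hu).hasFDerivAt hA hB h0
  have e2 := hasFDerivAt_energyB (h.norm_diff hu).hasFDerivAt hA hB h0
  refine ⟨_, (((e1.const_mul 2).fun_mul hC).fun_add (e2.fun_mul hW)).congr_of_eventuallyEq
    (h.eventually_fderiv_right hu hy w), fun z => ?_⟩
  simp [hA', hB', hC', hW']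
  ring

theorem hasFDerivAt_left (h : IsLocalModel L a b m U) (hu : u ∈ U) (hy : y ≠ 0) :
    ∃ f' : Coord n →L[ℝ] ℝ, HasFDerivAt (fun u' => L u' y ^ 2) f' u ∧ ∀ z, f' z =
        energyM (m u) (bilin (a u) y y) (lin (b u) y) * fderiv ℝ m u z
        + energyA (m u) (bilin (a u) y y) (lin (b u) y) * bilin (dMat a u z) y y
        + energyB (m u) (bilin (a u) y y) (lin (b u) y) * lin (dVec b u z) y := by
  obtain ⟨A', hA, hA'⟩ := hasFDerivAt_bilin (h.metric_diff hu) y y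
  obtain ⟨B', hB, hB'⟩ := hasFDerivAt_lin (h.form_diff hu) y
  have e1 := hasFDerivAt_energy (h.norm_diff hu).hasFDerivAt hA hB (h.metric_pos u hu y hy)
  refine ⟨_, e1.congr_of_eventuallyEq ?_, fun z => ?_⟩
  · filter_upwards [h.mem_nhds hu] with u' hu'
    exact h.sq_eq hu' y
  simp [hA', hB']

/-- The Euler-Lagrange equation of `F²`, contracted with a vector `w`. -/
theorem spray_eq (h : IsLocalModel L a b m U) (hu : u ∈ U) (hy : y ≠ 0)
    (hdet : (fundamentalTensor L u y).det ≠ 0) (w : Coord n) :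
    4 * bilin (fundamentalTensor L u y) w (WithLp.toLp 2 fun i => spray L i u y) =
      fderiv ℝ (fun u' => fderiv ℝ (fun y' => L u' y' ^ 2) y w) u y
        - fderiv ℝ (fun u' => L u' y ^ 2) u w := by
  have e : (fun i => spray L i u y) = fun i => ∑ l, (fundamentalTensor L u y)⁻¹ i l *
      (1 / 4 * ((∑ k, pd k (fun u' => pd l (fun y' => L u' y' ^ 2) y) u * y k)
      - pd l (fun u' => L u' y ^ 2) u)) := by
    funext i
    rw [spray, Finset.mul_sum]
    exact Finset.sum_congr rfl fun _ _ => by ring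
  have e1 : (fun u' => fderiv ℝ (fun y' => L u' y' ^ 2) y w) =
      fun u' => ∑ l, w l * pd l (fun y' => L u' y' ^ 2) y := by
    funext u'
    exact fderiv_apply_eq_sum _ _ _
  have hd (l : Fin n) : DifferentiableAt ℝ (fun u' => pd l (fun y' => L u' y' ^ 2) y) u := by
    obtain ⟨f', hf, -⟩ := h.hasFDerivAt_fderiv_right hu hy (EuclideanSpace.single l 1)
    exact hf.differentiableAt
  have e2 : HasFDerivAt (fun u' => ∑ l, w l * pd l (fun y' => L u' y' ^ 2) y)
      (∑ l, w l • fderiv ℝ (fun u' => pd l (fun y' => L u' y' ^ 2) y) u) u :=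
    HasFDerivAt.fun_sum fun l _ => (hd l).hasFDerivAt.const_mul (w l)
  rw [e, bilin_inv_mulVec (isUnit_iff_ne_zero.2 hdet), e1, e2.fderiv, lin_apply,
    fderiv_apply_eq_sum _ u w, sum_apply, ← Finset.sum_sub_distrib, Finset.mul_sum]
  refine Finset.sum_congr rfl fun l _ => ?_
  rw [smul_apply, fderiv_apply_eq_sum, smul_eq_mul]
  simp_rw [mul_comm (y _)]
  ring

end IsLocalModel

end

/-! ### Covariant derivatives and the explicit spray -/

section

variable {n : ℕ}

/-- The vector `γ^k_ij v^i w^j`. -/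
def christoffelVec (a : Coord n → Matrix (Fin n) (Fin n) ℝ) (u v w : Coord n) : Coord n :=
  WithLp.toLp 2 fun k => ∑ i, ∑ j, christoffel a k i j u * v i * w j

/-- The matrix `b_{i|j}`. -/
def covMat (a : Coord n → Matrix (Fin n) (Fin n) ℝ) (b : Coord n → Fin n → ℝ) (u : Coord n) :
    Matrix (Fin n) (Fin n) ℝ := Matrix.of fun i j => covDeriv a b i j u

/-- The matrix `r_ij`. -/
def rMat (a : Coord n → Matrix (Fin n) (Fin n) ℝ) (b : Coord n → Fin n → ℝ) (u : Coord n) :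
    Matrix (Fin n) (Fin n) ℝ := Matrix.of fun i j => rTensor a b i j u

/-- The matrix `s_ij`. -/
def sMat (a : Coord n → Matrix (Fin n) (Fin n) ℝ) (b : Coord n → Fin n → ℝ) (u : Coord n) :
    Matrix (Fin n) (Fin n) ℝ := Matrix.of fun i j => sTensor a b i j u

section
variable (a : Coord n → Matrix (Fin n) (Fin n) ℝ) (b : Coord n → Fin n → ℝ) (u : Coord n)

theorem bilin_rMat (v w : Coord n) :
    bilin (rMat a b u) v w = (bilin (covMat a b u) v w + bilin (covMat a b u) w v) / 2 := by
  have := bilin_eq_of_single (M := rMat a b u)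
    ((2⁻¹ : ℝ) • (bilin (covMat a b u) + (bilin (covMat a b u)).flip)) (fun i j => by
      simp [bilin_single, rMat, rTensor, covMat]; ring) v w
  rw [this]
  simp; ring

theorem bilin_sMat (v w : Coord n) :
    bilin (sMat a b u) v w = (bilin (covMat a b u) v w - bilin (covMat a b u) w v) / 2 := by
  have := bilin_eq_of_single (M := sMat a b u)
    ((2⁻¹ : ℝ) • (bilin (covMat a b u) - (bilin (covMat a b u)).flip)) (fun i j => by
      simp [bilin_single, sMat, sTensor, covMat]) v w
  rw [this]
  simp; ring

theorem lin_sForm (w : Coord n) :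
    lin (fun i => sForm a b i u) w = bilin (sMat a b u) (sharp a b u) w := by
  simp only [lin_apply, bilin_apply, sForm, Finset.sum_mul]
  rw [Finset.sum_comm]
  exact Finset.sum_congr rfl fun i _ => Finset.sum_congr rfl fun j _ => by
    simp only [sharp, sMat, Matrix.of_apply]; ring

theorem bilin_dMat (z v w : Coord n) :
    bilin (dMat a u z) v w = ∑ k, z k * bilin (Matrix.of fun i j => pd k (fun u' => a u' i j) u)
      v w := by
  simp only [bilin_apply, dMat, Matrix.of_apply, fderiv_apply_eq_sum, Finset.sum_mul,
    Finset.mul_sum]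
  symm
  rw [Finset.sum_comm]
  refine Finset.sum_congr rfl fun i _ => ?_
  rw [Finset.sum_comm]
  exact Finset.sum_congr rfl fun i _ => Finset.sum_congr rfl fun j _ => by ring

theorem bilin_dMat_single_left (l : Fin n) (v w : Coord n) :
    bilin (dMat a u v) (EuclideanSpace.single l 1) w =
      ∑ i, ∑ j, pd i (fun u' => a u' l j) u * v i * w j := by
  rw [bilin_dMat]
  refine Finset.sum_congr rfl fun i _ => ?_
  simp [bilin_apply, Finset.mul_sum]
  exact Finset.sum_congr rfl fun j _ => by ring

theorem lin_christoffelVec (c : Fin n → ℝ) (v w : Coord n) :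
    lin c (christoffelVec a u v w) =
      bilin (Matrix.of fun i j => ∑ k, christoffel a k i j u * c k) v w := by
  simp only [lin_apply, christoffelVec, bilin_apply, Matrix.of_apply, Finset.sum_mul,
    Finset.mul_sum]
  rw [Finset.sum_comm]
  refine Finset.sum_congr rfl fun i _ => ?_
  rw [Finset.sum_comm]
  exact Finset.sum_congr rfl fun i _ => Finset.sum_congr rfl fun j _ => by ring

theorem bilin_covMat (v w : Coord n) :
    bilin (covMat a b u) v w = lin (dVec b u w) v - lin (b u) (christoffelVec a u v w) := by
  have h1 : lin (dVec b u w) v = bilin (Matrix.of fun i j => pd j (fun u' => b u' i) u) v w := by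
    simp only [lin_apply, bilin_apply, dVec, fderiv_apply_eq_sum, Matrix.of_apply, Finset.sum_mul]
    exact Finset.sum_congr rfl fun i _ => Finset.sum_congr rfl fun j _ => by ring
  rw [h1, lin_christoffelVec]
  simp only [bilin_apply, ← Finset.sum_sub_distrib, covMat, covDeriv, Matrix.of_apply]
  exact Finset.sum_congr rfl fun i _ => Finset.sum_congr rfl fun j _ => by ring

end

/-- Solution of the contracted Euler-Lagrange equations for the radial coefficient. -/
def radialAux (m s β r s₀ my mb : ℝ) : ℝ :=
  ((m * s - β) * r - 4 * s ^ 2 * s₀ + 2 * s ^ 3 * mb - 2 * s * (m * s + 3 * β) * my)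
    / (3 * (m * s + β))

/-- The coefficient of `b^i` in the spray. -/
def sharpCoeff (m s β r s₀ my mb : ℝ) : ℝ :=
  s ^ 2 * (s * my + radialAux m s β r s₀ my mb) / (m * s - β) ^ 2

/-- The coefficient of `y^i` in the spray. -/
def radialCoeff (m s β r s₀ my mb : ℝ) : ℝ :=
  (s * (2 * m * s - 3 * β) * my + (m * s - 2 * β) * radialAux m s β r s₀ my mb) / (m * s - β) ^ 2

/-- The hypotheses are the Euler-Lagrange equations paired with y and with b^i, where X = a(y, Q)
and Z = β(Q). The conclusions are the two combinations of X and Z that occur in the equation paired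
with an arbitrary vector. -/
theorem solve_contracted {m A β X Z r s₀ my mb : ℝ} (hA : 0 < A) (hC : m * √A - β ≠ 0)
    (hD : m * √A + β ≠ 0)
    (ey : -4 * energyA m A β * X - energyM m A β * my
      + 2 * (energyAM m A β * my - 4 * energyAA m A β * X + energyAB m A β * (r - 2 * Z)) * A
      + (energyBM m A β * my - 4 * energyAB m A β * X + energyBB m A β * (r - 2 * Z)) * β = 0)
    (eb : -4 * energyA m A β * Z + 2 * energyB m A β * s₀ - energyM m A β * mb
      + 2 * (energyAM m A β * my - 4 * energyAA m A β * X + energyAB m A β * (r - 2 * Z)) * β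
      + (energyBM m A β * my - 4 * energyAB m A β * X + energyBB m A β * (r - 2 * Z)) * m ^ 2
      = 0) :
    energyAM m A β * my - 4 * energyAA m A β * X + energyAB m A β * (r - 2 * Z)
        = 2 * energyA m A β * radialCoeff m √A β r s₀ my mb ∧
      energyBM m A β * my - 4 * energyAB m A β * X + energyBB m A β * (r - 2 * Z)
        = 4 * energyA m A β * sharpCoeff m √A β r s₀ my mb := by
  simp only [energyA, energyM, energyAM, energyAA, energyAB, energyBM, energyBB, energyB] at *
  have hs : 0 < √A := Real.sqrt_pos.2 hA
  have hA2 : A = √A ^ 2 := (Real.sq_sqrt hA.le).symm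
  generalize √A = s at *
  subst hA2
  generalize hY : r - 2 * Z = Y at *
  obtain rfl : Z = (r - Y) / 2 := by rw [← hY]; ring
  -- Since s_ij y^i y^j = 0, the equation from y is free of s₀. After splitting off D³, it
  -- determines X from Y = r - 2Z, the coefficient of X being C.
  have hX : X = s ^ 2 * (s * my + Y) / (m * s - β) := by
    have : 4 * (m * s + β) ^ 3 / s ^ 4 * (-(m * s - β) * X + s ^ 3 * my + s ^ 2 * Y) = 0 := by
      rw [← ey]; field_simp; ring
    have := (mul_eq_zero.1 this).resolve_left (by positivity)
    rw [eq_div_iff hC]; linear_combination -this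
  subst hX
  -- With X eliminated, the equation from b^i is linear in Y alone, with coefficient 3D/2.
  have h3 : Y = radialAux m s β r s₀ my mb := by
    have : 4 * (m * s + β) ^ 3 / s ^ 4 * (-((m * s - β) * (r - Y) / 2) + 2 * s ^ 2 * s₀ -
        s ^ 3 * mb + s * (m * s + 3 * β) * my + (m * s + 2 * β) * Y) = 0 := by
      rw [← eb]; field_simp; ring
    have := (mul_eq_zero.1 this).resolve_left (by positivity)
    rw [radialAux, eq_div_iff (by positivity)]
    linear_combination 2 * this
  rw [radialCoeff, sharpCoeff, ← h3]
  constructor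
  · field_simp; ring
  · field_simp; ring

namespace IsLocalModel
variable {L : Coord n → Coord n → ℝ} {a : Coord n → Matrix (Fin n) (Fin n) ℝ}
  {b : Coord n → Fin n → ℝ} {m : Coord n → ℝ} {U : Set (Coord n)} {u y : Coord n}

theorem dMat_comm (h : IsLocalModel L a b m U) (hu : u ∈ U) (z v w : Coord n) :
    bilin (dMat a u z) v w = bilin (dMat a u z) w v := by
  refine bilin_comm (fun i j => ?_) v w
  have : (fun u' => a u' i j) =ᶠ[𝓝 u] fun u' => a u' j i := by
    filter_upwards [h.mem_nhds hu] with u' hu' using h.metric_symm u' hu' i j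
  simp only [dMat, Matrix.of_apply, this.fderiv_eq]

/-- The Koszul formula: lowering the index of γ^k_ij leaves only derivatives of a_ij. -/
theorem bilin_christoffelVec (h : IsLocalModel L a b m U) (hu : u ∈ U) (v w z : Coord n) :
    bilin (a u) z (christoffelVec a u v w) = (bilin (dMat a u v) z w + bilin (dMat a u w) z v
      - bilin (dMat a u z) v w) / 2 := by
  have e : christoffelVec a u v w = WithLp.toLp 2 fun k => ∑ l, (a u)⁻¹ k l *
      ((bilin (dMat a u v) (EuclideanSpace.single l 1) w
        + bilin (dMat a u w) (EuclideanSpace.single l 1) v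
        - bilin (dMat a u (EuclideanSpace.single l 1)) v w) / 2) := by
    rw [christoffelVec]
    congr 1
    funext k
    simp only [bilin_dMat_single_left]
    simp only [christoffel, Finset.mul_sum, Finset.sum_mul]
    rw [Finset.sum_congr rfl fun i _ => Finset.sum_comm, Finset.sum_comm]
    refine Finset.sum_congr rfl fun l _ => ?_
    rw [Finset.sum_comm (f := fun i j => pd i (fun u' => a u' l j) u * w i * v j), bilin_apply,
      ← Finset.sum_add_distrib, ← Finset.sum_sub_distrib, Finset.sum_div, Finset.mul_sum]
    refine Finset.sum_congr rfl fun i _ => ?_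
    rw [← Finset.sum_add_distrib, ← Finset.sum_sub_distrib, Finset.sum_div, Finset.mul_sum]
    refine Finset.sum_congr rfl fun j _ => ?_
    simp only [dMat, Matrix.of_apply, pd]
    ring
  rw [e, bilin_inv_mulVec (isUnit_det_of_pos (h.metric_pos u hu))]
  have e1 := map_eq_sum ((bilin (dMat a u v)).flip w) z
  have e2 := map_eq_sum ((bilin (dMat a u w)).flip v) z
  have e3 : bilin (dMat a u z) v w =
      ∑ l, z l * bilin (dMat a u (EuclideanSpace.single l 1)) v w := by
    rw [bilin_dMat]
    rfl
  simp only [LinearMap.flip_apply, smul_eq_mul] at e1 e2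
  rw [e1, e2, e3, lin_apply, ← Finset.sum_add_distrib, ← Finset.sum_sub_distrib, Finset.sum_div]
  exact Finset.sum_congr rfl fun i _ => by ring

/-- Freeze v = b^i at u. The function m² - 2β(v) + a(v, v) is the squared length of b^i - v, so it
has a minimum at u and its derivative vanishes there. This differentiates the norm without
differentiating a^{ij}. -/
theorem norm_mul_fderiv (h : IsLocalModel L a b m U) (hu : u ∈ U) (w : Coord n) :
    m u * fderiv ℝ m u w = bilin (covMat a b u) (sharp a b u) w := by
  set v := sharp a b u
  have hmin : IsLocalMin (fun u' => m u' ^ 2 - 2 * lin (b u') v + bilin (a u') v v) u := by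
    have h0 : m u ^ 2 - 2 * lin (b u) v + bilin (a u) v v = 0 := by
      rw [h.norm_sq u hu, h.bilin_sharp hu]; ring
    filter_upwards [h.mem_nhds hu] with u' hu'
    rw [h0, h.norm_sq u' hu', ← h.bilin_sharp hu', ← h.bilin_sharp hu']
    have e : bilin (a u') (sharp a b u' - v) (sharp a b u' - v) =
        bilin (a u') (sharp a b u') (sharp a b u') - 2 * bilin (a u') v (sharp a b u')
          + bilin (a u') v v := by
      simp only [map_sub, LinearMap.sub_apply, bilin_comm (h.metric_symm u' hu') _ v]
      ring
    rw [← e]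
    rcases eq_or_ne (sharp a b u' - v) 0 with h1 | h1
    · simp [h1]
    · exact (h.metric_pos u' hu' _ h1).le
  obtain ⟨A', hA, hA'⟩ := hasFDerivAt_bilin (h.metric_diff hu) v v
  obtain ⟨B', hB, hB'⟩ := hasFDerivAt_lin (h.form_diff hu) v
  have hd := ((((h.norm_diff hu).hasFDerivAt.pow 2).fun_sub (hB.const_mul 2)).fun_add hA)
  have := DFunLike.congr_fun (hmin.hasFDerivAt_eq_zero hd) w
  simp [hA', hB'] at this
  rw [bilin_covMat, ← h.bilin_sharp hu, bilin_comm (h.metric_symm u hu), h.bilin_christoffelVec hu]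
  rw [h.dMat_comm hu v]
  simp only [v] at *
  linarith

/-- The difference of the sprays of `F` and `α`. -/
def deviation (L : Coord n → Coord n → ℝ) (a : Coord n → Matrix (Fin n) (Fin n) ℝ)
    (u y : Coord n) : Coord n :=
  WithLp.toLp 2 (fun i => spray L i u y) - (2⁻¹ : ℝ) • christoffelVec a u y y

/-- Subtracting the spray of α from the Euler-Lagrange equation turns the derivatives of a_ij and
b_i into the tensors r_ij and s_ij. Q then enters only through a(w, Q), a(y, Q) and β(Q). -/
theorem deviation_eq (h : IsLocalModel L a b m U) (hu : u ∈ U) (hy : y ≠ 0)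
    (hdet : (fundamentalTensor L u y).det ≠ 0) (w : Coord n) :
    -4 * energyA (m u) (bilin (a u) y y) (lin (b u) y) * bilin (a u) w (deviation L a u y)
      + 2 * energyB (m u) (bilin (a u) y y) (lin (b u) y) * bilin (sMat a b u) w y
      - energyM (m u) (bilin (a u) y y) (lin (b u) y) * fderiv ℝ m u w
      + 2 * (energyAM (m u) (bilin (a u) y y) (lin (b u) y) * fderiv ℝ m u y
        - 4 * energyAA (m u) (bilin (a u) y y) (lin (b u) y) * bilin (a u) y (deviation L a u y)
        + energyAB (m u) (bilin (a u) y y) (lin (b u) y) *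
          (bilin (rMat a b u) y y - 2 * lin (b u) (deviation L a u y))) * bilin (a u) w y
      + (energyBM (m u) (bilin (a u) y y) (lin (b u) y) * fderiv ℝ m u y
        - 4 * energyAB (m u) (bilin (a u) y y) (lin (b u) y) * bilin (a u) y (deviation L a u y)
        + energyBB (m u) (bilin (a u) y y) (lin (b u) y) *
          (bilin (rMat a b u) y y - 2 * lin (b u) (deviation L a u y))) * lin (b u) w = 0 := by
  have key := h.spray_eq hu hy hdet w
  obtain ⟨f', hf, hf'⟩ := h.hasFDerivAt_fderiv_right hu hy w
  obtain ⟨g', hg, hg'⟩ := h.hasFDerivAt_left hu hy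
  have hG : WithLp.toLp 2 (fun i => spray L i u y) =
      deviation L a u y + (2⁻¹ : ℝ) • christoffelVec a u y y := by simp [deviation]
  rw [hf.fderiv, hg.fderiv, hf', hg', h.bilin_fundamentalTensor hu hy, hG] at key
  have c1 := h.bilin_christoffelVec hu y y y
  have c2 := h.bilin_christoffelVec hu y y w
  simp only [map_add, map_smul, smul_eq_mul, c1, c2] at key
  rw [bilin_rMat, bilin_sMat, bilin_covMat, bilin_covMat, bilin_covMat]
  have c3 : lin (b u) (christoffelVec a u y w) = lin (b u) (christoffelVec a u w y) := by
    rw [← h.bilin_sharp hu, ← h.bilin_sharp hu, bilin_comm (h.metric_symm u hu),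
      bilin_comm (h.metric_symm u hu) _ (sharp a b u), h.bilin_christoffelVec hu,
      h.bilin_christoffelVec hu, h.dMat_comm hu _ y w]
    ring
  rw [c3, h.dMat_comm hu y w y] at *
  rw [bilin_comm (h.metric_symm u hu) w y]
  linear_combination -key

/-- The spray of `F` away from the directions `±b^i`. -/
theorem bilin_deviation (h : IsLocalModel L a b m U) (hu : u ∈ U) (hy : y ≠ 0)
    (hdet : (fundamentalTensor L u y).det ≠ 0)
    (hC : m u * √(bilin (a u) y y) - lin (b u) y ≠ 0)
    (hD : m u * √(bilin (a u) y y) + lin (b u) y ≠ 0) (w : Coord n) :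
    bilin (a u) w (deviation L a u y) =
      2 * √(bilin (a u) y y) ^ 2 / (m u * √(bilin (a u) y y) - lin (b u) y)
          * bilin (sMat a b u) w y
      - √(bilin (a u) y y) ^ 3 / (m u * √(bilin (a u) y y) - lin (b u) y) * fderiv ℝ m u w
      + radialCoeff (m u) √(bilin (a u) y y) (lin (b u) y) (bilin (rMat a b u) y y)
          (bilin (sMat a b u) (sharp a b u) y) (fderiv ℝ m u y) (fderiv ℝ m u (sharp a b u))
          * bilin (a u) w y
      + sharpCoeff (m u) √(bilin (a u) y y) (lin (b u) y) (bilin (rMat a b u) y y)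
          (bilin (sMat a b u) (sharp a b u) y) (fderiv ℝ m u y) (fderiv ℝ m u (sharp a b u))
          * lin (b u) w := by
  have hA := h.metric_pos u hu y hy
  have ey := h.deviation_eq hu hy hdet y
  have eb := h.deviation_eq hu hy hdet (sharp a b u)
  have ew := h.deviation_eq hu hy hdet w
  have hs0 : bilin (sMat a b u) y y = 0 := by rw [bilin_sMat]; ring
  have hcomm := bilin_comm (h.metric_symm u hu) (sharp a b u)
  rw [hs0] at ey
  rw [hcomm, hcomm, h.bilin_sharp hu, h.bilin_sharp hu, ← h.norm_sq u hu] at eb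
  obtain ⟨e1, e2⟩ := solve_contracted (X := bilin (a u) y (deviation L a u y))
    (Z := lin (b u) (deviation L a u y)) (r := bilin (rMat a b u) y y)
    (s₀ := bilin (sMat a b u) (sharp a b u) y) (my := fderiv ℝ m u y)
    (mb := fderiv ℝ m u (sharp a b u)) hA hC hD
    (by linear_combination ey) (by linear_combination eb)
  rw [e1, e2] at ew
  have hs : 0 < √(bilin (a u) y y) := Real.sqrt_pos.2 hA
  have hA2 : bilin (a u) y y = √(bilin (a u) y y) ^ 2 := (Real.sq_sqrt hA.le).symm
  have hP : energyA (m u) (bilin (a u) y y) (lin (b u) y) ≠ 0 := by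
    rw [energyA]; positivity
  -- Both `energyB` and `energyM` are multiples of `energyA`, which is nonzero because CD ≠ 0. The
  -- equation can therefore be divided by 4 `energyA`.
  have h1 : energyB (m u) (bilin (a u) y y) (lin (b u) y) =
      4 * energyA (m u) (bilin (a u) y y) (lin (b u) y) *
        (√(bilin (a u) y y) ^ 2 / (m u * √(bilin (a u) y y) - lin (b u) y)) := by
    rw [energyA, energyB]
    generalize √(bilin (a u) y y) = s at *
    rw [hA2]; field_simp
  have h2 : energyM (m u) (bilin (a u) y y) (lin (b u) y) =
      4 * energyA (m u) (bilin (a u) y y) (lin (b u) y) *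
        (√(bilin (a u) y y) ^ 3 / (m u * √(bilin (a u) y y) - lin (b u) y)) := by
    rw [energyA, energyM]
    generalize √(bilin (a u) y y) = s at *
    rw [hA2]; field_simp
  rw [h1, h2] at ew
  refine mul_left_cancel₀ (mul_ne_zero four_ne_zero hP) ?_
  linear_combination -ew

end IsLocalModel

end

/-! ### Nondegenerate directions -/

section

variable {n : ℕ}

theorem det_eq_zero_iff_exists {M : Matrix (Fin n) (Fin n) ℝ} :
    M.det = 0 ↔ ∃ v : Coord n, v ≠ 0 ∧ ∀ w, bilin M w v = 0 := by
  rw [← Matrix.exists_mulVec_eq_zero_iff]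
  constructor
  · rintro ⟨v, hv, h⟩
    refine ⟨WithLp.toLp 2 v, by simpa using hv, fun w => ?_⟩
    rw [bilin_eq_sum_mul]
    refine Finset.sum_eq_zero fun i _ => ?_
    have := congrFun h i
    simp only [Matrix.mulVec, dotProduct, Pi.zero_apply] at this
    rw [this, mul_zero]
  · rintro ⟨v, hv, h⟩
    refine ⟨v.ofLp, by simpa using hv, funext fun i => ?_⟩
    have := h (EuclideanSpace.single i 1)
    simpa [bilin_apply, Matrix.mulVec, dotProduct] using this

/-- This is the main place where n ≥ 3 enters: a vector orthogonal to two given ones must exist. -/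
theorem exists_ne_zero_of_two_forms (hn : 3 ≤ n) (f g : Coord n →ₗ[ℝ] ℝ) :
    ∃ v, v ≠ 0 ∧ f v = 0 ∧ g v = 0 := by
  have h : (f.prod g).ker ≠ ⊥ := LinearMap.ker_ne_bot_of_finrank_lt (by simp; omega)
  obtain ⟨v, hv, h0⟩ := Submodule.exists_mem_ne_zero_of_ne_bot h
  exact ⟨v, h0, by simpa using hv⟩

/-- The hypotheses say that a kernel vector of g_ij pairs to zero with y and b^i. The first gives X
in terms of Z; the second then becomes a nonzero multiple of D⁴ Z. -/
theorem eq_zero_of_energy_hessian {m A β X Z : ℝ} (hA : 0 < A) (hC : m * √A - β ≠ 0)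
    (hD : m * √A + β ≠ 0)
    (ey : 2 * energyAA m A β * X * A + energyAB m A β * (β * X + Z * A) + energyA m A β * X
      + energyBB m A β / 2 * β * Z = 0)
    (eb : 2 * energyAA m A β * X * β + energyAB m A β * (m ^ 2 * X + Z * β) + energyA m A β * Z
      + energyBB m A β / 2 * m ^ 2 * Z = 0) : X = 0 ∧ Z = 0 := by
  simp only [energyA, energyAA, energyAB, energyBB] at *
  have hs : 0 < √A := Real.sqrt_pos.2 hA
  have hA2 : A = √A ^ 2 := (Real.sq_sqrt hA.le).symm
  generalize √A = s at *
  subst hA2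
  have hX : X = -2 * s ^ 2 * Z / (m * s - β) := by
    have : (m * s + β) ^ 3 / s ^ 4 * ((m * s - β) * X + 2 * s ^ 2 * Z) = 0 := by
      rw [← ey]; field_simp; ring
    have := (mul_eq_zero.1 this).resolve_left (by positivity)
    rw [eq_div_iff hC]; linear_combination this
  subst hX
  have hZ : Z = 0 := by
    have : 3 * (m * s + β) ^ 4 / s ^ 4 * Z = 0 := by
      rw [← eb]; field_simp; ring
    exact (mul_eq_zero.1 this).resolve_left (by positivity)
  subst hZ
  simp

namespace IsLocalModel
variable {L : Coord n → Coord n → ℝ} {a : Coord n → Matrix (Fin n) (Fin n) ℝ}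
  {b : Coord n → Fin n → ℝ} {m : Coord n → ℝ} {U : Set (Coord n)} {u y : Coord n}

theorem eq_zero_of_forall_bilin (h : IsLocalModel L a b m U) (hu : u ∈ U) {v : Coord n}
    (hv : ∀ w, bilin (a u) w v = 0) : v = 0 := by
  by_contra hne
  exact (h.metric_pos u hu v hne).ne' (hv v)

/-- `energyA` = C D³ / A². If it vanishes, any vector orthogonal to y and b^i is in the kernel of
g_ij. If not, a kernel vector is orthogonal to both, so only the term `energyA` · a_ij acts on it,
and positivity of a_ij makes it zero. -/
theorem det_ne_zero_iff (hn : 3 ≤ n) (h : IsLocalModel L a b m U) (hu : u ∈ U) (hy : y ≠ 0) :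
    (fundamentalTensor L u y).det ≠ 0 ↔ m u * √(bilin (a u) y y) - lin (b u) y ≠ 0 ∧
      m u * √(bilin (a u) y y) + lin (b u) y ≠ 0 := by
  have hA := h.metric_pos u hu y hy
  have hP : energyA (m u) (bilin (a u) y y) (lin (b u) y) = 0 ↔
      ¬ (m u * √(bilin (a u) y y) - lin (b u) y ≠ 0 ∧
        m u * √(bilin (a u) y y) + lin (b u) y ≠ 0) := by
    simp only [energyA, div_eq_zero_iff, mul_eq_zero, pow_eq_zero_iff, ne_eq, OfNat.ofNat_ne_zero,
      not_false_eq_true, hA.ne', or_false, not_and_or, not_not]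
    exact or_comm
  rw [ne_eq, det_eq_zero_iff_exists, not_iff_comm, ← hP]
  constructor
  · intro h0
    obtain ⟨v, hv, h1, h2⟩ := exists_ne_zero_of_two_forms hn (bilin (a u) y) (lin (b u))
    refine ⟨v, hv, fun w => ?_⟩
    rw [h.bilin_fundamentalTensor hu hy, h0, h1, h2]
    ring
  · rintro ⟨v, hv, hM⟩
    by_contra h0
    obtain ⟨hC, hD⟩ := not_not.1 (mt hP.2 h0)
    simp only [h.bilin_fundamentalTensor hu hy] at hM
    have ey := hM y
    have eb := hM (sharp a b u)
    rw [← h.norm_sq u hu, h.bilin_sharp hu, bilin_comm (h.metric_symm u hu) (sharp a b u) v,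
      h.bilin_sharp hu] at eb
    obtain ⟨hX, hZ⟩ := eq_zero_of_energy_hessian (X := bilin (a u) y v) (Z := lin (b u) v) hA hC hD
      (by linear_combination ey) (by linear_combination eb)
    refine hv (h.eq_zero_of_forall_bilin hu fun w => ?_)
    have := hM w
    rw [hX, hZ] at this
    simpa [h0] using this

end IsLocalModel

/-! ### Third derivatives of sprays that are quadratic up to a multiple of y -/

theorem pd_congr {f g : Coord n → ℝ} {y : Coord n} (h : f =ᶠ[𝓝 y] g) (l : Fin n) :
    pd l f =ᶠ[𝓝 y] pd l g := by
  filter_upwards [h.fderiv (𝕜 := ℝ)] with z hz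
  rw [pd, pd, hz]

theorem hasFDerivAt_linearMap (f : Coord n →ₗ[ℝ] ℝ) (y : Coord n) :
    HasFDerivAt (fun y => f y) f.toContinuousLinearMap y := f.toContinuousLinearMap.hasFDerivAt

theorem hasFDerivAt_bilin_diag (N : Matrix (Fin n) (Fin n) ℝ) (y : Coord n) :
    HasFDerivAt (fun y => bilin N y y)
      (bilin N y + (bilin N).flip y).toContinuousLinearMap y := by
  have h : (fun y => bilin N y y) = fun y => bilin ((2⁻¹ : ℝ) • (N + N.transpose)) y y := by
    funext y
    have := bilin_eq_of_single (M := (2⁻¹ : ℝ) • (N + N.transpose))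
      ((2⁻¹ : ℝ) • (bilin N + (bilin N).flip)) (fun i j => by simp [bilin_single]; ring) y y
    rw [this]; simp; ring
  rw [h]
  refine (hasFDerivAt_bilin_self (fun i j => by simp [add_comm]) y).congr_fderiv ?_
  ext w
  have := bilin_eq_of_single (M := (2⁻¹ : ℝ) • (N + N.transpose))
      ((2⁻¹ : ℝ) • (bilin N + (bilin N).flip)) (fun i j => by simp [bilin_single]; ring) y w
  rw [smul_apply, LinearMap.coe_toContinuousLinearMap', this]
  simp
  ring

theorem pd_bilin_diag (N : Matrix (Fin n) (Fin n) ℝ) (l : Fin n) :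
    pd l (fun y => bilin N y y) = fun y => (bilin N + (bilin N).flip)
      (EuclideanSpace.single l 1) y := by
  funext y
  rw [pd, (hasFDerivAt_bilin_diag N y).fderiv]
  simp [add_comm]

theorem pd_linearMap (f : Coord n →ₗ[ℝ] ℝ) (l : Fin n) :
    pd l (fun y => f y) = fun _ => f (EuclideanSpace.single l 1) := by
  funext y
  rw [pd, (hasFDerivAt_linearMap f y).fderiv]
  simp

theorem third_pd_eq_zero {f : Coord n → ℝ} {y : Coord n} (N : Matrix (Fin n) (Fin n) ℝ)
    (h : f =ᶠ[𝓝 y] fun y => bilin N y y) (j k l : Fin n) :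
    pd j (fun y₁ => pd k (fun y₂ => pd l f y₂) y₁) y = 0 := by
  have := (pd_congr (pd_congr (pd_congr h l) k) j).self_of_nhds
  rw [pd_bilin_diag, pd_linearMap] at this
  change pd j (pd k (pd l f)) y = 0
  rw [this, pd]
  simp

/-- The trace-free part of a spray of the form `N^i(y, y) + c √(A(y, y)) y^i` is quadratic. -/
theorem third_pd_projective_eq_zero {G : Fin n → Coord n → ℝ} {Ω : Set (Coord n)}
    (hΩ : IsOpen Ω) {A : Matrix (Fin n) (Fin n) ℝ} (hA : ∀ i j, A i j = A j i)
    (hpos : ∀ y ∈ Ω, 0 < bilin A y y) (N : Fin n → Matrix (Fin n) (Fin n) ℝ) (c : ℝ)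
    (hG : ∀ y ∈ Ω, ∀ i, G i y = bilin (N i) y y + c * √(bilin A y y) * y i)
    {y : Coord n} (hy : y ∈ Ω) (i j k l : Fin n) :
    pd j (fun y₁ => pd k (fun y₂ => pd l (fun y₃ =>
      G i y₃ - (1 / ((n : ℝ) + 1)) * (∑ m, pd m (fun y₄ => G m y₄) y₃) * y₃ i) y₂) y₁) y = 0 := by
  have hpd : ∀ z ∈ Ω, ∀ p, pd p (fun y₄ => G p y₄) z =
      (bilin (N p) + (bilin (N p)).flip) (EuclideanSpace.single p 1) z
        + c * (√(bilin A z z) + bilin A z (EuclideanSpace.single p 1) / √(bilin A z z) * z p) := by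
    intro z hz p
    have e : (fun y₄ => G p y₄) =ᶠ[𝓝 z] fun y => bilin (N p) y y + c * √(bilin A y y) * y p := by
      filter_upwards [hΩ.mem_nhds hz] with y hy using hG y hy p
    have hz0 := hpos z hz
    have d1 := hasFDerivAt_bilin_diag (N p) z
    have d2 := ((hasFDerivAt_bilin_self hA z).sqrt hz0.ne').const_mul c
    have d3 : HasFDerivAt (fun y : Coord n => y p) (EuclideanSpace.proj p : Coord n →L[ℝ] ℝ) z :=
      (EuclideanSpace.proj p : Coord n →L[ℝ] ℝ).hasFDerivAt
    rw [(pd_congr e p).self_of_nhds, pd, (d1.fun_add (d2.fun_mul d3)).fderiv]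
    have hs : √(bilin A z z) ≠ 0 := (Real.sqrt_pos.2 hz0).ne'
    simp
    field_simp
    ring
  set ℓ : Coord n →ₗ[ℝ] ℝ := ∑ p, (bilin (N p) + (bilin (N p)).flip) (EuclideanSpace.single p 1)
  have hsum : ∀ z ∈ Ω, ∑ p, pd p (fun y₄ => G p y₄) z = ℓ z + c * (n + 1) * √(bilin A z z) := by
    intro z hz
    have hs : √(bilin A z z) ≠ 0 := (Real.sqrt_pos.2 (hpos z hz)).ne'
    -- Euler's identity for √A, homogeneous of degree 1. With the n terms from differentiating y^p
    -- it makes the divergence of √A y equal to (n + 1)√A, which the factor 1/(n + 1) normalises.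
    have h1 : ∑ p, bilin A z (EuclideanSpace.single p 1) / √(bilin A z z) * z p =
        √(bilin A z z) := by
      rw [← mul_left_inj' hs, Real.mul_self_sqrt (hpos z hz).le]
      conv_rhs => rw [map_eq_sum (bilin A z) z]
      rw [Finset.sum_mul]
      refine Finset.sum_congr rfl fun p _ => ?_
      rw [smul_eq_mul]
      field_simp
    rw [Finset.sum_congr rfl fun p _ => hpd z hz p, Finset.sum_add_distrib, ← Finset.mul_sum,
      Finset.sum_add_distrib, h1]
    simp only [ℓ, LinearMap.sum_apply, Finset.sum_const, Finset.card_univ, Fintype.card_fin,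
      nsmul_eq_mul]
    ring
  -- The c√A y terms cancel. What remains is N^i minus the product of y^i with the linear divergence
  -- ℓ/(n + 1) of the quadratic part.
  refine third_pd_eq_zero (N i - Matrix.of fun p q =>
    1 / ((n : ℝ) + 1) * ℓ (EuclideanSpace.single p 1) * (if q = i then 1 else 0)) ?_ j k l
  filter_upwards [hΩ.mem_nhds hy] with z hz
  rw [hG z hz, hsum z hz]
  have := bilin_eq_of_single (M := N i - Matrix.of fun p q =>
    1 / ((n : ℝ) + 1) * ℓ (EuclideanSpace.single p 1) * (if q = i then 1 else 0))
    (bilin (N i) - (1 / ((n : ℝ) + 1)) •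
      ℓ.smulRight (EuclideanSpace.proj i : Coord n →L[ℝ] ℝ).toLinearMap)
    (fun p q => by simp [bilin_single, eq_comm]) z z
  rw [this]
  have : (n : ℝ) + 1 ≠ 0 := by positivity
  simp
  field_simp
  ring

end

/-! ### The structure equations imply vanishing Douglas curvature -/

section

variable {n : ℕ}

theorem bilin_sMat_self (a : Coord n → Matrix (Fin n) (Fin n) ℝ) (b : Coord n → Fin n → ℝ)
    (u v : Coord n) : bilin (sMat a b u) v v = 0 := by
  rw [bilin_sMat]; ring

theorem bilin_sMat_swap (a : Coord n → Matrix (Fin n) (Fin n) ℝ) (b : Coord n → Fin n → ℝ)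
    (u v w : Coord n) : bilin (sMat a b u) v w = -bilin (sMat a b u) w v := by
  rw [bilin_sMat, bilin_sMat]; ring

theorem bilin_covMat_eq_add (a : Coord n → Matrix (Fin n) (Fin n) ℝ) (b : Coord n → Fin n → ℝ)
    (u v w : Coord n) :
    bilin (covMat a b u) v w = bilin (rMat a b u) v w + bilin (sMat a b u) v w := by
  rw [bilin_sMat, bilin_rMat]; ring

/-- The structure equations in terms of vectors. -/
theorem structureEquations_iff (a : Coord n → Matrix (Fin n) (Fin n) ℝ) (b : Coord n → Fin n → ℝ)
    (N c d : ℝ) (u : Coord n) :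
    StructureEquations a b N c d u ↔ ∀ v w,
      bilin (rMat a b u) v w = c * bilin (a u) v w + d * lin (b u) v * lin (b u) w
        - 3 / N ^ 2 * (bilin (sMat a b u) (sharp a b u) v * lin (b u) w
          + bilin (sMat a b u) (sharp a b u) w * lin (b u) v) ∧
      bilin (sMat a b u) v w = 1 / N ^ 2 * (lin (b u) v * bilin (sMat a b u) (sharp a b u) w
        - lin (b u) w * bilin (sMat a b u) (sharp a b u) v) := by
  have hσ : ∀ i, sForm a b i u = bilin (sMat a b u) (sharp a b u) (EuclideanSpace.single i 1) := by
    intro i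
    rw [← lin_sForm, lin_single]
  constructor
  · intro h v w
    set σ := bilin (sMat a b u) (sharp a b u)
    set g := lin (b u)
    constructor
    · have := bilin_eq_of_single (M := rMat a b u) (c • bilin (a u) + d • g.smulRight g
        - (3 / N ^ 2) • (σ.smulRight g + g.smulRight σ)) (fun i j => by
          rw [rMat, Matrix.of_apply, (h i j).1, hσ, hσ]
          simp [bilin_single, lin_single, g, σ]
          ring) v w
      rw [this]
      simp
      ring
    · have := bilin_eq_of_single (M := sMat a b u) ((1 / N ^ 2) • (g.smulRight σ - σ.smulRight g))
        (fun i j => by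
          rw [sMat, Matrix.of_apply, (h i j).2, hσ, hσ]
          simp [lin_single, g, σ, mul_comm]) v w
      rw [this]
      simp [mul_comm]
  · intro h i j
    have := h (EuclideanSpace.single i 1) (EuclideanSpace.single j 1)
    simp only [bilin_single, lin_single, ← hσ] at this
    exact this

namespace IsLocalModel
variable {L : Coord n → Coord n → ℝ} {a : Coord n → Matrix (Fin n) (Fin n) ℝ}
  {b : Coord n → Fin n → ℝ} {m : Coord n → ℝ} {U : Set (Coord n)} {u y : Coord n}

theorem isOpen_regular (u : Coord n) (a : Coord n → Matrix (Fin n) (Fin n) ℝ)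
    (b : Coord n → Fin n → ℝ) (m : Coord n → ℝ) :
    IsOpen {y : Coord n | y ≠ 0 ∧ m u * √(bilin (a u) y y) - lin (b u) y ≠ 0 ∧
      m u * √(bilin (a u) y y) + lin (b u) y ≠ 0} := by
  have h1 : Continuous fun y : Coord n => bilin (a u) y y := by
    simp only [bilin_apply]; fun_prop
  have h2 : Continuous fun y : Coord n => lin (b u) y := by
    simp only [lin_apply]; fun_prop
  refine isOpen_ne.inter ((isOpen_ne_fun ?_ continuous_const).inter
    (isOpen_ne_fun ?_ continuous_const)) <;> fun_prop

/-- The spray when `s_ij = (b_i s_j - b_j s_i) / b²` and `b_{|i} = (κ b_i - 2 s_i) / b`. -/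
theorem bilin_deviation_of_sMat (h : IsLocalModel L a b m U) (hu : u ∈ U) (hy : y ≠ 0)
    (hdet : (fundamentalTensor L u y).det ≠ 0)
    (hC : m u * √(bilin (a u) y y) - lin (b u) y ≠ 0)
    (hD : m u * √(bilin (a u) y y) + lin (b u) y ≠ 0) {κ ρ : ℝ}
    (hs : ∀ v w, bilin (sMat a b u) v w = 1 / m u ^ 2 *
      (lin (b u) v * bilin (sMat a b u) (sharp a b u) w
        - lin (b u) w * bilin (sMat a b u) (sharp a b u) v))
    (hm : ∀ w, m u * fderiv ℝ m u w = κ * lin (b u) w - 2 * bilin (sMat a b u) (sharp a b u) w)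
    (hr : bilin (rMat a b u) y y = κ * lin (b u) y ^ 2 / m u ^ 2
      - 6 * lin (b u) y * bilin (sMat a b u) (sharp a b u) y / m u ^ 2 + ρ) (w : Coord n) :
    bilin (a u) w (deviation L a u y) =
      ((√(bilin (a u) y y) * (2 * m u * √(bilin (a u) y y) - 3 * lin (b u) y)
          * (κ * lin (b u) y - 2 * bilin (sMat a b u) (sharp a b u) y) / m u
        + (m u * √(bilin (a u) y y) - 2 * lin (b u) y) *
          (2 * lin (b u) y * bilin (sMat a b u) (sharp a b u) y / m u ^ 2
            + κ * (2 * m u ^ 2 * √(bilin (a u) y y) ^ 2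
              - 4 * m u * √(bilin (a u) y y) * lin (b u) y - lin (b u) y ^ 2) / (3 * m u ^ 2)
            + (m u * √(bilin (a u) y y) - lin (b u) y) * ρ
              / (3 * (m u * √(bilin (a u) y y) + lin (b u) y))))
        / (m u * √(bilin (a u) y y) - lin (b u) y) ^ 2) * bilin (a u) w y
      + 2 * √(bilin (a u) y y) ^ 2 / m u ^ 2 * bilin (sMat a b u) (sharp a b u) w
      - √(bilin (a u) y y) ^ 2 / 3 * (κ / m u ^ 2
        - ρ / ((m u * √(bilin (a u) y y) - lin (b u) y) *
          (m u * √(bilin (a u) y y) + lin (b u) y))) * lin (b u) w := by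
  have hm0 := h.norm_pos u hu
  have hm' : ∀ w, fderiv ℝ m u w =
      (κ * lin (b u) w - 2 * bilin (sMat a b u) (sharp a b u) w) / m u := fun w => by
    rw [eq_div_iff hm0.ne', mul_comm, hm]
  have hmb : fderiv ℝ m u (sharp a b u) = κ * m u := by
    rw [hm', bilin_sMat_self, ← h.norm_sq u hu]; field_simp; ring
  rw [h.bilin_deviation hu hy hdet hC hD w, hs w y, hr, hmb, hm', hm']
  generalize √(bilin (a u) y y) = s at *
  generalize lin (b u) y = β at *
  generalize bilin (sMat a b u) (sharp a b u) y = σ at *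
  have hY : radialAux (m u) s β (κ * β ^ 2 / m u ^ 2 - 6 * β * σ / m u ^ 2 + ρ) σ
      ((κ * β - 2 * σ) / m u) (κ * m u) = 2 * β * σ / m u ^ 2
        + κ * (2 * m u ^ 2 * s ^ 2 - 4 * m u * s * β - β ^ 2) / (3 * m u ^ 2)
        + (m u * s - β) * ρ / (3 * (m u * s + β)) := by
    rw [radialAux]; field_simp; ring
  rw [radialCoeff, sharpCoeff, hY]
  generalize bilin (sMat a b u) (sharp a b u) w = τ
  generalize lin (b u) w = x
  generalize bilin (a u) w y = η
  clear hY hmb hm hm' hr hs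
  generalize m u = N at *
  have hC' : s * N - β ≠ 0 := by rwa [mul_comm]
  have hD' : s * N + β ≠ 0 := by rwa [mul_comm]
  field_simp
  ring

/-- `b b_{|i} = (c + d b²) b_i - 2 s_i`. -/
theorem norm_mul_fderiv_of_structureEquations (h : IsLocalModel L a b m U) (hu : u ∈ U) {c d : ℝ}
    (hS : StructureEquations a b (m u) c d u) (w : Coord n) :
    m u * fderiv ℝ m u w = (c + d * m u ^ 2) * lin (b u) w
      - 2 * bilin (sMat a b u) (sharp a b u) w := by
  have hm0 := h.norm_pos u hu
  rw [h.norm_mul_fderiv hu, bilin_covMat_eq_add,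
    ((structureEquations_iff a b (m u) c d u).1 hS (sharp a b u) w).1, bilin_sMat_self,
    ← h.norm_sq u hu, bilin_comm (h.metric_symm u hu), h.bilin_sharp hu]
  field_simp
  ring

/-- The part of r_ij y^i y^j coming from the component of y orthogonal to b^i is c(A - β²/b²) = c
CD/b². This factor CD cancels the denominators in the general formula for Q, which leaves only √A
and polynomials in y. -/
theorem deviation_of_structureEquations (h : IsLocalModel L a b m U) (hu : u ∈ U) (hy : y ≠ 0)
    (hdet : (fundamentalTensor L u y).det ≠ 0)
    (hC : m u * √(bilin (a u) y y) - lin (b u) y ≠ 0)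
    (hD : m u * √(bilin (a u) y y) + lin (b u) y ≠ 0) {c d : ℝ}
    (hS : StructureEquations a b (m u) c d u) :
    deviation L a u y =
      ((2 * (c + d * m u ^ 2) + c) / (3 * m u) * √(bilin (a u) y y)
        + (2 * (c + d * m u ^ 2) - 2 * c) / (3 * m u ^ 2) * lin (b u) y
        - 4 / m u ^ 2 * bilin (sMat a b u) (sharp a b u) y) • y
      + bilin (a u) y y • ((2 / m u ^ 2) • (WithLp.toLp 2 fun i =>
        ∑ j, (a u)⁻¹ i j * sForm a b j u : Coord n) - (d / 3) • sharp a b u) := by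
  have hm0 := h.norm_pos u hu
  have hA := h.metric_pos u hu y hy
  have hA2 : √(bilin (a u) y y) ^ 2 = bilin (a u) y y := Real.sq_sqrt hA.le
  have hS' := (structureEquations_iff a b (m u) c d u).1 hS
  rw [← sub_eq_zero]
  refine h.eq_zero_of_forall_bilin hu fun w => ?_
  have key := h.bilin_deviation_of_sMat hu hy hdet hC hD (κ := c + d * m u ^ 2)
    (ρ := c * ((m u * √(bilin (a u) y y) - lin (b u) y) *
      (m u * √(bilin (a u) y y) + lin (b u) y)) / m u ^ 2) (fun v w => (hS' v w).2)
    (h.norm_mul_fderiv_of_structureEquations hu hS) (by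
      rw [(hS' y y).1]
      nth_rw 1 [← hA2]
      field_simp
      ring) w
  have e := bilin_inv_mulVec (isUnit_det_of_pos (h.metric_pos u hu)) (fun i => sForm a b i u) w
  simp only [map_sub, map_add, map_smul, smul_eq_mul, e, h.bilin_sharp hu, key, lin_sForm]
  generalize √(bilin (a u) y y) = s at *
  rw [← hA2]
  generalize lin (b u) y = β at *
  generalize bilin (sMat a b u) (sharp a b u) y = σ at *
  generalize bilin (sMat a b u) (sharp a b u) w = τ at *
  generalize lin (b u) w = x at *
  generalize bilin (a u) w y = η at *
  clear key e hS' hS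
  generalize m u = N at *
  have hC' : s * N - β ≠ 0 := by rwa [mul_comm]
  have hD' : s * N + β ≠ 0 := by rwa [mul_comm]
  field_simp
  ring

theorem douglasCurvature_eq_zero (hn : 3 ≤ n) (h : IsLocalModel L a b m U) (hu : u ∈ U)
    (hy : y ≠ 0) (hdet : (fundamentalTensor L u y).det ≠ 0) {c d : ℝ}
    (hS : StructureEquations a b (m u) c d u) (i j k l : Fin n) :
    douglasCurvature L i j k l u y = 0 := by
  set e : Coord n := (2 / m u ^ 2) • (WithLp.toLp 2 fun i =>
    ∑ j, (a u)⁻¹ i j * sForm a b j u : Coord n) - (d / 3) • sharp a b u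
  set ℓ : Coord n →ₗ[ℝ] ℝ := ((2 * (c + d * m u ^ 2) - 2 * c) / (3 * m u ^ 2)) • lin (b u)
    - (4 / m u ^ 2) • bilin (sMat a b u) (sharp a b u)
  refine third_pd_projective_eq_zero (G := fun p => spray L p u) (isOpen_regular u a b m) (h.metric_symm u hu)
    (fun z hz => h.metric_pos u hu z hz.1)
    -- The summands are the spray of α, the linear multiple of y, and A times a fixed vector. The √A
    -- multiple of y is passed separately as the scalar that follows.
    (fun p => Matrix.of fun i j => 2⁻¹ * christoffel a p i j u
      + ℓ (EuclideanSpace.single i 1) * (if j = p then 1 else 0) + a u i j * e p)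
    ((2 * (c + d * m u ^ 2) + c) / (3 * m u)) (fun z hz p => ?_)
    ⟨hy, (h.det_ne_zero_iff hn hu hy).1 hdet⟩ i j k l
  have h1 := h.deviation_of_structureEquations hu hz.1
    ((h.det_ne_zero_iff hn hu hz.1).2 hz.2) hz.2.1 hz.2.2 hS
  have h2 : spray L p u z = deviation L a u z p + 2⁻¹ * christoffelVec a u z z p := by
    simp [deviation]
  have h3 := bilin_eq_of_single (M := Matrix.of fun i j => 2⁻¹ * christoffel a p i j u
      + ℓ (EuclideanSpace.single i 1) * (if j = p then 1 else 0) + a u i j * e p)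
    ((2⁻¹ : ℝ) • bilin (Matrix.of fun i j => christoffel a p i j u)
      + ℓ.smulRight (EuclideanSpace.proj p : Coord n →L[ℝ] ℝ).toLinearMap
      + (e p) • bilin (a u)) (fun i j => by simp [bilin_single, eq_comm, mul_comm]) z z
  rw [h2, h1, h3]
  have h4 : christoffelVec a u z z p = bilin (Matrix.of fun i j => christoffel a p i j u) z z := rfl
  rw [h4]
  simp [ℓ, e]
  ring

end IsLocalModel

end

/-! ### Vanishing Douglas curvature along lines -/

section

variable {n : ℕ}

theorem contDiff_bilin_diag (N : Matrix (Fin n) (Fin n) ℝ) :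
    ContDiff ℝ ∞ fun y : Coord n => bilin N y y := by
  simp only [bilin_apply]; fun_prop

theorem contDiff_linearMap (f : Coord n →ₗ[ℝ] ℝ) : ContDiff ℝ ∞ fun y : Coord n => f y :=
  f.toContinuousLinearMap.contDiff

theorem contDiffOn_pd {f : Coord n → ℝ} {Ω : Set (Coord n)} (hf : ContDiffOn ℝ ∞ f Ω)
    (hΩ : IsOpen Ω) (l : Fin n) : ContDiffOn ℝ ∞ (pd l f) Ω :=
  (hf.fderiv_of_isOpen hΩ (by simp)).clm_apply contDiffOn_const

/-- The directional derivative along a line in terms of partial derivatives. -/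
theorem hasDerivAt_comp_line {f : Coord n → ℝ} {Ω : Set (Coord n)} (hf : ContDiffOn ℝ ∞ f Ω)
    (hΩ : IsOpen Ω) {y z : Coord n} {t : ℝ} (ht : y + t • z ∈ Ω) :
    HasDerivAt (fun t : ℝ => f (y + t • z)) (∑ l, z l * pd l f (y + t • z)) t := by
  have h1 : HasDerivAt (fun t : ℝ => y + t • z) z t := by
    simpa using ((hasDerivAt_id t).smul_const z).const_add y
  have h2 := ((hf.contDiffAt (hΩ.mem_nhds ht)).differentiableAt (by simp)).hasFDerivAt
  rw [← fderiv_apply_eq_sum]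
  exact h2.comp_hasDerivAt t h1

theorem eq_quadratic_of_hasDerivAt {f : ℝ → ℝ} {c₀ c₁ : ℝ}
    (h : ∀ t, HasDerivAt f (c₀ + c₁ * t) t) (t : ℝ) : f t = f 0 + c₀ * t + c₁ / 2 * t ^ 2 := by
  have h1 : ∀ t, HasDerivAt (fun t => f t - (c₀ * t + c₁ / 2 * t ^ 2)) 0 t := fun t => by
    have := (h t).sub (((hasDerivAt_id t).const_mul c₀).add
      (((hasDerivAt_id t).pow 2).const_mul (c₁ / 2)))
    refine (this.congr_deriv ?_)
    simp; ring
  have := is_const_of_deriv_eq_zero (fun t => (h1 t).differentiableAt) (fun t => (h1 t).deriv) t 0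
  linear_combination this

/-- A function with vanishing third partial derivatives is quadratic along lines. -/
theorem exists_quadratic_along_line {f : Coord n → ℝ} {Ω : Set (Coord n)}
    (hf : ContDiffOn ℝ ∞ f Ω) (hΩ : IsOpen Ω)
    (h3 : ∀ y ∈ Ω, ∀ j k l, pd j (pd k (pd l f)) y = 0) {y z : Coord n}
    (hyz : ∀ t : ℝ, y + t • z ∈ Ω) :
    ∃ c₀ c₁ c₂ : ℝ, ∀ t : ℝ, f (y + t • z) = c₀ + c₁ * t + c₂ * t ^ 2 := by
  -- Integrate three times: second partials are constant on the line, first partials affine, and f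
  -- quadratic.
  have h2 : ∀ k l, ∀ t : ℝ, pd k (pd l f) (y + t • z) = pd k (pd l f) y := by
    intro k l t
    have := eq_quadratic_of_hasDerivAt (f := fun t : ℝ => pd k (pd l f) (y + t • z)) (c₀ := 0)
      (c₁ := 0) (fun t => by
        refine (hasDerivAt_comp_line (contDiffOn_pd (contDiffOn_pd hf hΩ l) hΩ k) hΩ (hyz t)).congr_deriv ?_
        simp [h3 _ (hyz t)]) t
    simpa using this
  have h1 : ∀ l, ∃ c₀ c₁ : ℝ, ∀ t : ℝ, pd l f (y + t • z) = c₀ + c₁ * t := by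
    intro l
    refine ⟨_, _, fun t => (eq_quadratic_of_hasDerivAt (f := fun t : ℝ => pd l f (y + t • z))
      (c₀ := ∑ k, z k * pd k (pd l f) y) (c₁ := 0) (fun t => ?_) t).trans
      (by rw [zero_div, zero_mul, add_zero])⟩
    refine (hasDerivAt_comp_line (contDiffOn_pd hf hΩ l) hΩ (hyz t)).congr_deriv ?_
    simp [h2]
  choose c₀ c₁ hc using h1
  refine ⟨_, _, _, fun t => eq_quadratic_of_hasDerivAt (f := fun t : ℝ => f (y + t • z))
    (c₀ := ∑ l, z l * c₀ l) (c₁ := ∑ l, z l * c₁ l) (fun t => ?_) t⟩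
  refine (hasDerivAt_comp_line hf hΩ (hyz t)).congr_deriv ?_
  rw [Finset.sum_mul, ← Finset.sum_add_distrib]
  exact Finset.sum_congr rfl fun l _ => by rw [hc]; ring

namespace IsLocalModel
variable {L : Coord n → Coord n → ℝ} {a : Coord n → Matrix (Fin n) (Fin n) ℝ}
  {b : Coord n → Fin n → ℝ} {m : Coord n → ℝ} {U : Set (Coord n)} {u y : Coord n}

/-- The tangent vectors at `u` that are not multiples of `b^i`. -/
def regular (a : Coord n → Matrix (Fin n) (Fin n) ℝ) (b : Coord n → Fin n → ℝ) (m : Coord n → ℝ)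
    (u : Coord n) : Set (Coord n) :=
  {y : Coord n | y ≠ 0 ∧ m u * √(bilin (a u) y y) - lin (b u) y ≠ 0 ∧
      m u * √(bilin (a u) y y) + lin (b u) y ≠ 0}

/-- The explicit formula is valid on the whole open set of regular vectors, and its denominators C
and D do not vanish there. Smoothness is what permits integrating the vanishing third partials. -/
theorem contDiffOn_bilin_deviation (hn : 3 ≤ n) (h : IsLocalModel L a b m U) (hu : u ∈ U)
    (w : Coord n) :
    ContDiffOn ℝ ∞ (fun y => bilin (a u) w (deviation L a u y)) (regular a b m u) := by
  have hS : ContDiffOn ℝ ∞ (fun y => √(bilin (a u) y y)) (regular a b m u) :=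
    (contDiff_bilin_diag (a u)).contDiffOn.sqrt fun y hy => (h.metric_pos u hu y hy.1).ne'
  have hβ := (contDiff_linearMap (lin (b u))).contDiffOn (s := regular a b m u)
  have hr := (contDiff_bilin_diag (rMat a b u)).contDiffOn (s := regular a b m u)
  have hσ := (contDiff_linearMap (bilin (sMat a b u) (sharp a b u))).contDiffOn
    (s := regular a b m u)
  have hm := (fderiv ℝ m u).contDiff.contDiffOn (s := regular a b m u) (n := ∞)
  have hs := (contDiff_linearMap (bilin (sMat a b u) w)).contDiffOn (s := regular a b m u)
  have ha := (contDiff_linearMap (bilin (a u) w)).contDiffOn (s := regular a b m u)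
  have hC : ContDiffOn ℝ ∞ (fun y => m u * √(bilin (a u) y y) - lin (b u) y)
    (regular a b m u) := (contDiffOn_const.mul hS).sub hβ
  have hD : ContDiffOn ℝ ∞ (fun y => m u * √(bilin (a u) y y) + lin (b u) y)
    (regular a b m u) := (contDiffOn_const.mul hS).add hβ
  have hC0 : ∀ y ∈ regular a b m u, m u * √(bilin (a u) y y) - lin (b u) y ≠ 0 := fun y hy => hy.2.1
  have hD0 : ∀ y ∈ regular a b m u, 3 * (m u * √(bilin (a u) y y) + lin (b u) y) ≠ 0 :=
    fun y hy => mul_ne_zero three_ne_zero hy.2.2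
  have hC2 : ∀ y ∈ regular a b m u, (m u * √(bilin (a u) y y) - lin (b u) y) ^ 2 ≠ 0 :=
    fun y hy => pow_ne_zero 2 hy.2.1
  have hY : ContDiffOn ℝ ∞ (fun y => radialAux (m u) √(bilin (a u) y y) (lin (b u) y)
      (bilin (rMat a b u) y y) (bilin (sMat a b u) (sharp a b u) y) (fderiv ℝ m u y)
      (fderiv ℝ m u (sharp a b u))) (regular a b m u) := by
    simp only [radialAux]
    refine ContDiffOn.div ?_ (contDiffOn_const.mul hD) hD0
    fun_prop
  have hp : ContDiffOn ℝ ∞ (fun y => radialCoeff (m u) √(bilin (a u) y y) (lin (b u) y)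
      (bilin (rMat a b u) y y) (bilin (sMat a b u) (sharp a b u) y) (fderiv ℝ m u y)
      (fderiv ℝ m u (sharp a b u))) (regular a b m u) := by
    simp only [radialCoeff]
    refine ContDiffOn.div ?_ (hC.pow 2) hC2
    fun_prop
  have hq : ContDiffOn ℝ ∞ (fun y => sharpCoeff (m u) √(bilin (a u) y y) (lin (b u) y)
      (bilin (rMat a b u) y y) (bilin (sMat a b u) (sharp a b u) y) (fderiv ℝ m u y)
      (fderiv ℝ m u (sharp a b u))) (regular a b m u) := by
    simp only [sharpCoeff]
    refine ContDiffOn.div ?_ (hC.pow 2) hC2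
    fun_prop
  refine ContDiffOn.congr ?_ fun y hy => h.bilin_deviation hu hy.1
    ((h.det_ne_zero_iff hn hu hy.1).2 hy.2) hy.2.1 hy.2.2 w
  exact (((((contDiffOn_const.mul (hS.pow 2)).div hC hC0).mul hs).sub
    (((hS.pow 3).div hC hC0).mul contDiffOn_const)).add (hp.mul ha)).add (hq.mul contDiffOn_const)

theorem contDiffOn_spray (hn : 3 ≤ n) (h : IsLocalModel L a b m U) (hu : u ∈ U) (i : Fin n) :
    ContDiffOn ℝ ∞ (fun y => spray L i u y) (regular a b m u) := by
  have e : ∀ y, spray L i u y = bilin (a u) (WithLp.toLp 2 fun k =>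
      ∑ j, (a u)⁻¹ k j * (if j = i then 1 else 0)) (deviation L a u y)
        + 2⁻¹ * bilin (Matrix.of fun p q => christoffel a i p q u) y y := by
    intro y
    have h4 : christoffelVec a u y y i = bilin (Matrix.of fun p q => christoffel a i p q u) y y :=
      rfl
    rw [bilin_comm (h.metric_symm u hu),
      bilin_inv_mulVec (isUnit_det_of_pos (h.metric_pos u hu)), ← h4]
    simp [lin_apply, deviation]
  simp only [e]
  exact (h.contDiffOn_bilin_deviation hn hu _).add
    (contDiffOn_const.mul (contDiff_bilin_diag _).contDiffOn)

/-- If the Douglas curvature vanishes, the components of the deviation orthogonal to a line are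
quadratic along this line. -/
theorem deviation_quadratic_along_line (hn : 3 ≤ n) (h : IsLocalModel L a b m U) (hu : u ∈ U)
    (hD : ∀ y : Coord n, y ≠ 0 → (fundamentalTensor L u y).det ≠ 0 →
      ∀ i j k l : Fin n, douglasCurvature L i j k l u y = 0) {y z w : Coord n}
    (hyz : ∀ t : ℝ, y + t • z ∈ regular a b m u) (hwy : bilin (a u) w y = 0)
    (hwz : bilin (a u) w z = 0) :
    ∃ c₀ c₁ c₂ : ℝ, ∀ t : ℝ, bilin (a u) w (deviation L a u (y + t • z)) =
      c₀ + c₁ * t + c₂ * t ^ 2 := by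
  have hΩ : IsOpen (regular a b m u) := isOpen_regular u a b m
  have hG := h.contDiffOn_spray hn hu
  have hsum : ContDiffOn ℝ ∞ (fun y => ∑ p, pd p (fun y₄ => spray L p u y₄) y)
      (regular a b m u) := ContDiffOn.sum fun p _ => contDiffOn_pd (hG p) hΩ p
  have hT : ∀ i, ∃ c₀ c₁ c₂ : ℝ, ∀ t : ℝ, spray L i u (y + t • z) - (1 / ((n : ℝ) + 1)) *
      (∑ p, pd p (fun y₄ => spray L p u y₄) (y + t • z)) * (y + t • z) i =
        c₀ + c₁ * t + c₂ * t ^ 2 := by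
    intro i
    refine exists_quadratic_along_line (f := fun y₃ => spray L i u y₃ - (1 / ((n : ℝ) + 1)) *
      (∑ p, pd p (fun y₄ => spray L p u y₄) y₃) * y₃ i) ?_ hΩ (fun y hy j k l => ?_) hyz
    · refine (hG i).sub ((contDiffOn_const.mul hsum).mul ?_)
      fun_prop
    · exact hD y hy.1 ((h.det_ne_zero_iff hn hu hy.1).2 hy.2) i j k l
  choose c₀ c₁ c₂ hc using hT
  have hq := h.bilin_christoffelVec hu
  refine ⟨∑ i, bilin (a u) w (EuclideanSpace.single i 1) * c₀ i
      - 2⁻¹ * bilin (a u) w (christoffelVec a u y y),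
    ∑ i, bilin (a u) w (EuclideanSpace.single i 1) * c₁ i
      - 2⁻¹ * (bilin (a u) w (christoffelVec a u y z) + bilin (a u) w (christoffelVec a u z y)),
    ∑ i, bilin (a u) w (EuclideanSpace.single i 1) * c₂ i
      - 2⁻¹ * bilin (a u) w (christoffelVec a u z z), fun t => ?_⟩
  have hchr : bilin (a u) w (christoffelVec a u (y + t • z) (y + t • z)) =
      bilin (a u) w (christoffelVec a u y y) + t * (bilin (a u) w (christoffelVec a u y z)
        + bilin (a u) w (christoffelVec a u z y)) + t ^ 2 * bilin (a u) w (christoffelVec a u z z)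
      := by
    have hadd : ∀ (x x' v v' : Coord n) (t : ℝ), bilin (dMat a u (x + t • x')) v v' =
        bilin (dMat a u x) v v' + t * bilin (dMat a u x') v v' := by
      intro x x' v v' t
      simp only [bilin_dMat, PiLp.add_apply, PiLp.smul_apply, smul_eq_mul, add_mul,
        Finset.sum_add_distrib, mul_assoc, Finset.mul_sum]
    simp only [hq, hadd, map_add, map_smul, LinearMap.add_apply, LinearMap.smul_apply, smul_eq_mul]
    ring
  have hG' : bilin (a u) w (WithLp.toLp 2 fun i => spray L i u (y + t • z)) =
      ∑ i, bilin (a u) w (EuclideanSpace.single i 1) * (c₀ i + c₁ i * t + c₂ i * t ^ 2) := by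
    simp only [← hc]
    have e1 := map_eq_sum (bilin (a u) w) (WithLp.toLp 2 fun i => spray L i u (y + t • z))
    -- As w is orthogonal to the whole line, the trace correction, a multiple of the point itself,
    -- disappears on pairing with w.
    have e2 : ∑ i, (y + t • z) i * bilin (a u) w (EuclideanSpace.single i 1) = 0 := by
      have := map_eq_sum (bilin (a u) w) (y + t • z)
      simp only [smul_eq_mul] at this
      rw [← this, map_add, map_smul, hwy, hwz]; simp
    rw [e1]
    generalize (1 / ((n : ℝ) + 1)) * (∑ p, pd p (fun y₄ => spray L p u y₄) (y + t • z)) = μ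
    have e3 : ∑ i, bilin (a u) w (EuclideanSpace.single i 1) *
        (spray L i u (y + t • z) - μ * (y + t • z) i) =
        ∑ i, spray L i u (y + t • z) * bilin (a u) w (EuclideanSpace.single i 1)
          - μ * ∑ i, (y + t • z) i * bilin (a u) w (EuclideanSpace.single i 1) := by
      rw [Finset.mul_sum, ← Finset.sum_sub_distrib]
      exact Finset.sum_congr rfl fun i _ => by ring
    rw [e3, e2, mul_zero, sub_zero]
    rfl
  rw [deviation, map_sub, map_smul, hG', hchr]
  simp only [mul_add, Finset.sum_add_distrib, ← mul_assoc, ← Finset.sum_mul, smul_eq_mul]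
  ring

end IsLocalModel

end

/-! ### Vanishing Douglas curvature implies the structure equations -/

section

variable {n : ℕ}

/-- `√(k + l t²)` is not a quotient of polynomials. -/
theorem eq_zero_of_sqrt_mul_eq {k l p₀ p₁ p₂ q₀ q₁ q₂ q₃ : ℝ} (hk : 0 < k) (hl : 0 < l)
    (h : ∀ t : ℝ, √(k + l * t ^ 2) * (p₀ + p₁ * t + p₂ * t ^ 2) =
      q₀ + q₁ * t + q₂ * t ^ 2 + q₃ * t ^ 3) :
    p₀ = 0 ∧ p₁ = 0 ∧ p₂ = 0 := by
  -- The root is even in t, so the even and odd parts of the identity separate. Squaring each part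
  -- removes the root.
  have he : ∀ t : ℝ, (k + l * t ^ 2) * (p₀ + p₂ * t ^ 2) ^ 2 = (q₀ + q₂ * t ^ 2) ^ 2 := by
    intro t
    have h1 := h t
    have h2 := h (-t)
    rw [neg_sq] at h2
    have h3 : √(k + l * t ^ 2) * (p₀ + p₂ * t ^ 2) = q₀ + q₂ * t ^ 2 := by linarith
    rw [← h3, mul_pow, Real.sq_sqrt (by positivity)]
  have ho : ∀ t : ℝ, (k + l * t ^ 2) * (p₁ * t) ^ 2 = (q₁ * t + q₃ * t ^ 3) ^ 2 := by
    intro t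
    have h1 := h t
    have h2 := h (-t)
    rw [neg_sq] at h2
    have h3 : √(k + l * t ^ 2) * (p₁ * t) = q₁ * t + q₃ * t ^ 3 := by linarith
    rw [← h3, mul_pow (√_), Real.sq_sqrt (by positivity)]
  -- In T = t² the two sides of `he` have degrees 3 and 2. The weights form the third divided
  -- difference at T = 0, 1, 4, 9, which extracts l p₂². The later weights are divided differences
  -- of the same kind.
  have hp2 : p₂ = 0 := by
    have : l * p₂ ^ 2 = 0 := by
      linear_combination -(1 / 36) * he 0 + 1 / 24 * he 1 - 1 / 60 * he 2 + 1 / 360 * he 3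
    simpa [hl.ne'] using this
  subst hp2
  have hq2 : q₂ = 0 := by
    have : q₂ ^ 2 = 0 := by
      linear_combination -(1 / 4) * he 0 + 1 / 3 * he 1 - 1 / 12 * he 2
    simpa using this
  subst hq2
  have hp0 : p₀ = 0 := by
    have : l * p₀ ^ 2 = 0 := by linear_combination he 1 - he 0
    simpa [hl.ne'] using this
  -- For the odd part both sides vanish at T = 0, so that node needs no sample.
  have hq3 : q₃ = 0 := by
    have : q₃ ^ 2 = 0 := by
      linear_combination -(1 / 24) * ho 1 + 1 / 60 * ho 2 - 1 / 360 * ho 3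
    simpa using this
  subst hq3
  have hp1 : p₁ = 0 := by
    have : l * p₁ ^ 2 = 0 := by linear_combination -(1 / 3) * ho 1 + 1 / 12 * ho 2
    simpa [hl.ne'] using this
  exact ⟨hp0, hp1, rfl⟩

namespace IsLocalModel
variable {L : Coord n → Coord n → ℝ} {a : Coord n → Matrix (Fin n) (Fin n) ℝ}
  {b : Coord n → Fin n → ℝ} {m : Coord n → ℝ} {U : Set (Coord n)} {u y : Coord n}

/-- CD = b²A - β², so strict Cauchy-Schwarz makes both factors nonzero. -/
theorem mem_regular (h : IsLocalModel L a b m U) (hu : u ∈ U)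
    (hy : lin (b u) y ^ 2 < m u ^ 2 * bilin (a u) y y) : y ∈ regular a b m u := by
  have hy0 : y ≠ 0 := by rintro rfl; simp at hy
  have h0 : 0 ≤ bilin (a u) y y := (h.metric_pos u hu y hy0).le
  have e : (m u * √(bilin (a u) y y) - lin (b u) y) * (m u * √(bilin (a u) y y) + lin (b u) y) ≠ 0
    := by
    have : (m u * √(bilin (a u) y y) - lin (b u) y) * (m u * √(bilin (a u) y y) + lin (b u) y) =
        m u ^ 2 * bilin (a u) y y - lin (b u) y ^ 2 := by
      linear_combination m u ^ 2 * Real.sq_sqrt h0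
    rw [this]; linarith
  exact ⟨hy0, left_ne_zero_of_mul e, right_ne_zero_of_mul e⟩

theorem lin_sharp (h : IsLocalModel L a b m U) (hu : u ∈ U) : lin (b u) (sharp a b u) = m u ^ 2 :=
  (h.norm_sq u hu).symm

theorem sharp_bilin (h : IsLocalModel L a b m U) (hu : u ∈ U) (w : Coord n) :
    bilin (a u) (sharp a b u) w = lin (b u) w := by
  rw [bilin_comm (h.metric_symm u hu), h.bilin_sharp hu]

/-- On the line v + t b^i one has β = t b² and A = a(v, v) + b² t². Pairing with w orthogonal to v
and b^i kills the y and b^i terms of Q. What is left is irrational in t unless the coefficient of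
the root vanishes. -/
theorem sMat_orthogonal_of_douglas (hn : 3 ≤ n) (h : IsLocalModel L a b m U) (hu : u ∈ U)
    (hD : ∀ y : Coord n, y ≠ 0 → (fundamentalTensor L u y).det ≠ 0 →
      ∀ i j k l : Fin n, douglasCurvature L i j k l u y = 0) {v w : Coord n} (hv0 : v ≠ 0)
    (hv : lin (b u) v = 0) (hw : lin (b u) w = 0) (hwv : bilin (a u) w v = 0) :
    bilin (sMat a b u) w v = 0 ∧
      m u * fderiv ℝ m u w = 2 * bilin (sMat a b u) w (sharp a b u) := by
  have hm0 := h.norm_pos u hu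
  have hvv := h.metric_pos u hu v hv0
  have hA : ∀ t : ℝ, bilin (a u) (v + t • sharp a b u) (v + t • sharp a b u) =
      bilin (a u) v v + m u ^ 2 * t ^ 2 := fun t => by
    simp only [map_add, map_smul, LinearMap.add_apply, LinearMap.smul_apply, smul_eq_mul,
      h.bilin_sharp hu, h.sharp_bilin hu, hv, h.lin_sharp hu]
    ring
  have hβ : ∀ t : ℝ, lin (b u) (v + t • sharp a b u) = t * m u ^ 2 := fun t => by
    simp only [map_add, map_smul, smul_eq_mul, hv, h.lin_sharp hu, zero_add]
  have hreg : ∀ t : ℝ, v + t • sharp a b u ∈ regular a b m u := fun t => by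
    refine h.mem_regular hu ?_
    rw [hA, hβ]
    nlinarith [mul_pos (pow_pos hm0 2) hvv]
  have hwb : bilin (a u) w (sharp a b u) = 0 := by rw [h.bilin_sharp hu, hw]
  obtain ⟨c₀, c₁, c₂, hc⟩ := h.deviation_quadratic_along_line hn hu hD hreg hwv hwb
  -- The formula for a(w, Q) multiplied by C, with s³ rewritten as sA and all terms odd in s
  -- collected on the left.
  have key : ∀ t : ℝ, √(bilin (a u) v v + m u ^ 2 * t ^ 2) *
      ((m u * c₀ + bilin (a u) v v * fderiv ℝ m u w) + m u * c₁ * t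
        + (m u * c₂ + m u ^ 2 * fderiv ℝ m u w) * t ^ 2) =
      2 * bilin (a u) v v * bilin (sMat a b u) w v
        + (m u ^ 2 * c₀ + 2 * bilin (a u) v v * bilin (sMat a b u) w (sharp a b u)) * t
        + (m u ^ 2 * c₁ + 2 * m u ^ 2 * bilin (sMat a b u) w v) * t ^ 2
        + (m u ^ 2 * c₂ + 2 * m u ^ 2 * bilin (sMat a b u) w (sharp a b u)) * t ^ 3 := by
    intro t
    obtain ⟨h0, hC, hD'⟩ := hreg t
    have e := h.bilin_deviation hu h0 ((h.det_ne_zero_iff hn hu h0).2 ⟨hC, hD'⟩) hC hD' w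
    have hwy : bilin (a u) w (v + t • sharp a b u) = 0 := by rw [map_add, map_smul, hwv, hwb]; simp
    rw [hc, hwy, hw, map_add (bilin (sMat a b u) w), map_smul (bilin (sMat a b u) w), hA, hβ] at e
    rw [hA, hβ] at hC
    have hs : √(bilin (a u) v v + m u ^ 2 * t ^ 2) ^ 2 = bilin (a u) v v + m u ^ 2 * t ^ 2 :=
      Real.sq_sqrt (by positivity)
    generalize √(bilin (a u) v v + m u ^ 2 * t ^ 2) = s at *
    have e' : (m u * s - t * m u ^ 2) * (c₀ + c₁ * t + c₂ * t ^ 2) =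
        2 * s ^ 2 * (bilin (sMat a b u) w v + t * bilin (sMat a b u) w (sharp a b u))
          - s ^ 3 * fderiv ℝ m u w := by
      rw [e]
      rw [smul_eq_mul, mul_zero, mul_zero, add_zero, add_zero]
      generalize m u * s - t * m u ^ 2 = C at hC ⊢
      field_simp
    have e3 : s ^ 3 = s * (bilin (a u) v v + m u ^ 2 * t ^ 2) := by rw [← hs]; ring
    rw [e3, hs] at e'
    linear_combination e'
  obtain ⟨h0, h1, h2⟩ := eq_zero_of_sqrt_mul_eq hvv (pow_pos hm0 2) key
  have k0 := key 0
  have k1 := key 1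
  rw [h0, h1, h2] at k0 k1
  have hs0 : bilin (sMat a b u) w v = 0 := by
    have : bilin (a u) v v * bilin (sMat a b u) w v = 0 := by linear_combination -k0 / 2
    exact (mul_eq_zero.1 this).resolve_left hvv.ne'
  refine ⟨hs0, ?_⟩
  have hc1 : c₁ = 0 := (mul_eq_zero.1 h1).resolve_left hm0.ne'
  rw [hs0, hc1] at k1
  have : (bilin (a u) v v + m u ^ 2) * (2 * bilin (sMat a b u) w (sharp a b u)
      - m u * fderiv ℝ m u w) = 0 := by
    linear_combination -k1 - m u * h0 - m u * h2
  have := (mul_eq_zero.1 this).resolve_left (by positivity)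
  linarith

/-- The component of a vector orthogonal to `b^i`. -/
theorem lin_sub_smul_sharp (h : IsLocalModel L a b m U) (hu : u ∈ U) (v : Coord n) :
    lin (b u) (v - (lin (b u) v / m u ^ 2) • sharp a b u) = 0 := by
  have := h.norm_pos u hu
  rw [map_sub, map_smul, h.lin_sharp hu, smul_eq_mul]
  field_simp
  ring

theorem sMat_of_douglas (hn : 3 ≤ n) (h : IsLocalModel L a b m U) (hu : u ∈ U)
    (hD : ∀ y : Coord n, y ≠ 0 → (fundamentalTensor L u y).det ≠ 0 →
      ∀ i j k l : Fin n, douglasCurvature L i j k l u y = 0) (v w : Coord n) :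
    bilin (sMat a b u) v w = 1 / m u ^ 2 *
      (lin (b u) v * bilin (sMat a b u) (sharp a b u) w
        - lin (b u) w * bilin (sMat a b u) (sharp a b u) v) := by
  have hm0 := h.norm_pos u hu
  have key : ∀ v w, lin (b u) v = 0 → lin (b u) w = 0 → bilin (sMat a b u) w v = 0 := by
    intro v w hv hw
    rcases eq_or_ne v 0 with rfl | hv0
    · simp
    have hvv := h.metric_pos u hu v hv0
    -- Removing the v-component of w does not change s(w, v), since s_ij is alternating.
    have := (h.sMat_orthogonal_of_douglas hn hu hD (v := v)
      (w := w - (bilin (a u) w v / bilin (a u) v v) • v) hv0 hv (by simp [hv, hw]) (by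
        simp only [map_sub, map_smul, LinearMap.sub_apply, LinearMap.smul_apply, smul_eq_mul]
        field_simp
        ring)).1
    simpa [bilin_sMat_self] using this
  have := key _ _ (h.lin_sub_smul_sharp hu w) (h.lin_sub_smul_sharp hu v)
  simp only [map_sub, map_smul, LinearMap.sub_apply, LinearMap.smul_apply, smul_eq_mul,
    bilin_sMat_self, bilin_sMat_swap a b u v (sharp a b u)] at this
  linear_combination this

/-- Split w along b^i and its orthogonal complement. The orthogonal part comes from the lines v + t
b^i, where v must be orthogonal to both w's orthogonal part and b^i. The part along b^i is the
general identity b b_{|j} = b^i b_{i|j}. -/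
theorem norm_mul_fderiv_of_douglas (hn : 3 ≤ n) (h : IsLocalModel L a b m U) (hu : u ∈ U)
    (hD : ∀ y : Coord n, y ≠ 0 → (fundamentalTensor L u y).det ≠ 0 →
      ∀ i j k l : Fin n, douglasCurvature L i j k l u y = 0) (w : Coord n) :
    m u * fderiv ℝ m u w =
      bilin (rMat a b u) (sharp a b u) (sharp a b u) / m u ^ 2 * lin (b u) w
        - 2 * bilin (sMat a b u) (sharp a b u) w := by
  have hm0 := h.norm_pos u hu
  have hw := h.lin_sub_smul_sharp hu w
  obtain ⟨v, hv0, hwv, hv⟩ := exists_ne_zero_of_two_forms hn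
    (bilin (a u) (w - (lin (b u) w / m u ^ 2) • sharp a b u)) (lin (b u))
  have h1 := (h.sMat_orthogonal_of_douglas hn hu hD hv0 hv hw hwv).2
  have h2 := h.norm_mul_fderiv hu (sharp a b u)
  rw [bilin_covMat_eq_add, bilin_sMat_self] at h2
  simp only [map_sub, map_smul, LinearMap.sub_apply, LinearMap.smul_apply, smul_eq_mul,
    bilin_sMat_self, bilin_sMat_swap a b u w (sharp a b u)] at h1
  linear_combination h1 + lin (b u) w / m u ^ 2 * h2

theorem rMat_comm (a : Coord n → Matrix (Fin n) (Fin n) ℝ) (b : Coord n → Fin n → ℝ)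
    (u v w : Coord n) : bilin (rMat a b u) v w = bilin (rMat a b u) w v := by
  rw [bilin_rMat, bilin_rMat, add_comm]

/-- b b_{|j} = b^i r_ij + s_j, so the -2 s_j in the derivative of the norm becomes -3 s_j here. This
is the origin of the coefficient 3 in the structure equations. -/
theorem rMat_sharp_of_douglas (hn : 3 ≤ n) (h : IsLocalModel L a b m U) (hu : u ∈ U)
    (hD : ∀ y : Coord n, y ≠ 0 → (fundamentalTensor L u y).det ≠ 0 →
      ∀ i j k l : Fin n, douglasCurvature L i j k l u y = 0) (w : Coord n) :
    bilin (rMat a b u) (sharp a b u) w =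
      bilin (rMat a b u) (sharp a b u) (sharp a b u) / m u ^ 2 * lin (b u) w
        - 3 * bilin (sMat a b u) (sharp a b u) w := by
  have h1 := h.norm_mul_fderiv_of_douglas hn hu hD w
  rw [h.norm_mul_fderiv hu, bilin_covMat_eq_add] at h1
  linarith

/-- Split y along b^i and its orthogonal complement: the terms involving b^i are already known, and
the last summand is the only part of r_ij still to be determined. -/
theorem rMat_self_of_douglas (hn : 3 ≤ n) (h : IsLocalModel L a b m U) (hu : u ∈ U)
    (hD : ∀ y : Coord n, y ≠ 0 → (fundamentalTensor L u y).det ≠ 0 →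
      ∀ i j k l : Fin n, douglasCurvature L i j k l u y = 0) (y : Coord n) :
    bilin (rMat a b u) y y =
      bilin (rMat a b u) (sharp a b u) (sharp a b u) / m u ^ 2 * lin (b u) y ^ 2 / m u ^ 2
      - 6 * lin (b u) y * bilin (sMat a b u) (sharp a b u) y / m u ^ 2
      + bilin (rMat a b u) (y - (lin (b u) y / m u ^ 2) • sharp a b u)
        (y - (lin (b u) y / m u ^ 2) • sharp a b u) := by
  have h1 := h.rMat_sharp_of_douglas hn hu hD y
  have hm0 := h.norm_pos u hu
  simp only [map_sub, map_smul, LinearMap.sub_apply, LinearMap.smul_apply, smul_eq_mul,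
    rMat_comm a b u y (sharp a b u)]
  rw [h1]
  field_simp
  ring

/-- On the line b^i + e + tf both β and CD/(1 + t²) are constant, and A = b² + 1 + t². The quadratic
law then says that 1 + t² divides (b² + 1 + t²) ρ(t), where ρ(t) = r(e + tf, e + tf). Hence it
divides ρ, which has degree at most 2. -/
theorem rMat_orthonormal_of_douglas (hn : 3 ≤ n) (h : IsLocalModel L a b m U) (hu : u ∈ U)
    (hD : ∀ y : Coord n, y ≠ 0 → (fundamentalTensor L u y).det ≠ 0 →
      ∀ i j k l : Fin n, douglasCurvature L i j k l u y = 0) {e f : Coord n}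
    (he : lin (b u) e = 0) (hf : lin (b u) f = 0) (hee : bilin (a u) e e = 1)
    (hff : bilin (a u) f f = 1) (hef : bilin (a u) e f = 0) :
    bilin (rMat a b u) e f = 0 ∧ bilin (rMat a b u) e e = bilin (rMat a b u) f f := by
  have hm0 := h.norm_pos u hu
  have hfe : bilin (a u) f e = 0 := by rw [bilin_comm (h.metric_symm u hu), hef]
  set κ := bilin (rMat a b u) (sharp a b u) (sharp a b u) / m u ^ 2
  have hA : ∀ t : ℝ, bilin (a u) (sharp a b u + e + t • f) (sharp a b u + e + t • f) =
      m u ^ 2 + 1 + t ^ 2 := fun t => by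
    simp only [map_add, map_smul, LinearMap.add_apply, LinearMap.smul_apply, smul_eq_mul,
      h.bilin_sharp hu, h.sharp_bilin hu, he, hf, h.lin_sharp hu, hee, hff, hef, hfe]
    ring
  have hβ : ∀ t : ℝ, lin (b u) (sharp a b u + e + t • f) = m u ^ 2 := fun t => by
    simp [he, hf, h.lin_sharp hu]
  have hreg : ∀ t : ℝ, sharp a b u + e + t • f ∈ regular a b m u := fun t => by
    refine h.mem_regular hu ?_
    rw [hA, hβ]
    nlinarith [pow_pos hm0 2, mul_nonneg (pow_pos hm0 2).le (sq_nonneg t)]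
  -- Chosen orthogonal to the whole line but not to b^i, so that the coefficient of b^i in Q is
  -- visible.
  set w := sharp a b u - (m u ^ 2) • e
  have hw1 : bilin (a u) w (sharp a b u + e) = 0 := by
    simp [w, h.bilin_sharp hu, h.sharp_bilin hu, he, h.lin_sharp hu, hee]
  have hw2 : bilin (a u) w f = 0 := by simp [w, h.sharp_bilin hu, hf, hef]
  have hw3 : lin (b u) w = m u ^ 2 := by simp [w, he, h.lin_sharp hu]
  obtain ⟨c₀, c₁, c₂, hc⟩ := h.deviation_quadratic_along_line hn hu hD hreg hw1 hw2
  set τ := bilin (sMat a b u) (sharp a b u) w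
  have key : ∀ t : ℝ, (m u ^ 2 + 1 + t ^ 2) * (bilin (rMat a b u) e e
      + 2 * t * bilin (rMat a b u) e f + t ^ 2 * bilin (rMat a b u) f f) =
      (1 + t ^ 2) * (3 * (c₀ + c₁ * t + c₂ * t ^ 2)
        - (m u ^ 2 + 1 + t ^ 2) * (6 * τ / m u ^ 2 - κ)) := by
    intro t
    obtain ⟨h0, hC, hD'⟩ := hreg t
    have hr := h.rMat_self_of_douglas hn hu hD (sharp a b u + e + t • f)
    have e1 : sharp a b u + e + t • f - (m u ^ 2 / m u ^ 2) • sharp a b u = e + t • f := by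
      rw [div_self (by positivity), one_smul]; abel
    rw [hβ, e1] at hr
    have hdev := h.bilin_deviation_of_sMat hu h0 ((h.det_ne_zero_iff hn hu h0).2 ⟨hC, hD'⟩) hC hD'
      (κ := κ) (ρ := bilin (rMat a b u) (e + t • f) (e + t • f)) (h.sMat_of_douglas hn hu hD)
      (h.norm_mul_fderiv_of_douglas hn hu hD) (by rw [hβ, hr]) w
    have hwy : bilin (a u) w (sharp a b u + e + t • f) = 0 := by
      rw [map_add, map_smul, hw1, hw2]; simp
    rw [hc, hwy, mul_zero, zero_add, hβ, hw3, hA] at hdev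
    have hs : √(m u ^ 2 + 1 + t ^ 2) ^ 2 = m u ^ 2 + 1 + t ^ 2 := Real.sq_sqrt (by positivity)
    have hCD : (m u * √(m u ^ 2 + 1 + t ^ 2) - m u ^ 2) * (m u * √(m u ^ 2 + 1 + t ^ 2) + m u ^ 2)
        = m u ^ 2 * (1 + t ^ 2) := by linear_combination m u ^ 2 * hs
    have hrr : bilin (rMat a b u) (e + t • f) (e + t • f) = bilin (rMat a b u) e e
      + 2 * t * bilin (rMat a b u) e f + t ^ 2 * bilin (rMat a b u) f f := by
      simp only [map_add, map_smul, LinearMap.add_apply, LinearMap.smul_apply, smul_eq_mul,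
        rMat_comm a b u f e]
      ring
    rw [hCD, hs, hrr] at hdev
    rw [hdev]
    have : 1 + t ^ 2 ≠ 0 := by positivity
    simp only [τ]
    field_simp
    ring
  have k0 := key 0
  have k1 := key 1
  have k2 := key (-1)
  have k3 := key 2
  have k4 := key (-2)
  have hm2 : m u ^ 2 ≠ 0 := by positivity
  -- Evaluate `key` at t = i, where 1 + t² vanishes and b² ρ(i) = 0 remains. For a quartic, these
  -- weights on the samples at 0, ±1, ±2 give half the imaginary part and the real part of its value
  -- at i.
  constructor
  · refine (mul_eq_zero.1 (?_ : m u ^ 2 * _ = 0)).resolve_left hm2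
    linear_combination (k1 - k2) * (5 / 12) - (k3 - k4) * (1 / 12)
  · rw [← sub_eq_zero]
    refine (mul_eq_zero.1 (?_ : m u ^ 2 * _ = 0)).resolve_left hm2
    linear_combination (15 * k0 - 5 * (k1 + k2) + (k3 + k4) / 2) / 6

/-- Take c = r(e, e) for one unit vector e orthogonal to b^i. Any v orthogonal to b^i is a
combination of e and a unit f orthogonal to e, so r = c a there. The value of r_ij b^i b^j then
fixes d, and polarisation gives the bilinear equation. -/
theorem exists_structureEquations (hn : 3 ≤ n) (h : IsLocalModel L a b m U) (hu : u ∈ U)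
    (hD : ∀ y : Coord n, y ≠ 0 → (fundamentalTensor L u y).det ≠ 0 →
      ∀ i j k l : Fin n, douglasCurvature L i j k l u y = 0) :
    ∃ c d, StructureEquations a b (m u) c d u := by
  have hm0 := h.norm_pos u hu
  obtain ⟨e₀, he0, heb, -⟩ := exists_ne_zero_of_two_forms hn (lin (b u)) (lin (b u))
  have unit : ∀ v : Coord n, v ≠ 0 → ∃ (t : ℝ) (e : Coord n), bilin (a u) e e = 1 ∧ v = t • e := by
    intro v hv
    have hvv := h.metric_pos u hu v hv
    have hs : √(bilin (a u) v v) ≠ 0 := (Real.sqrt_pos.2 hvv).ne'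
    refine ⟨√(bilin (a u) v v), (√(bilin (a u) v v))⁻¹ • v, ?_, ?_⟩
    · have := Real.sq_sqrt hvv.le
      simp only [map_smul, LinearMap.smul_apply, smul_eq_mul]
      field_simp
      exact this.symm
    · rw [smul_smul, mul_inv_cancel₀ hs, one_smul]
  obtain ⟨t₀, e, hee, rfl⟩ := unit e₀ he0
  have ht0 : t₀ ≠ 0 := by rintro rfl; simp at he0
  have he : lin (b u) e = 0 := by simpa [ht0] using heb
  have key : ∀ v, lin (b u) v = 0 →
      bilin (rMat a b u) v v = bilin (rMat a b u) e e * bilin (a u) v v := by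
    intro v hv
    rcases eq_or_ne (v - bilin (a u) e v • e) 0 with h0 | h0
    · rw [sub_eq_zero] at h0
      rw [h0]
      simp only [map_smul, LinearMap.smul_apply, smul_eq_mul, hee]
      ring
    · obtain ⟨t, f, hff, hvf⟩ := unit _ h0
      have ht : t ≠ 0 := by rintro rfl; simp [hvf] at h0
      have hf : lin (b u) f = 0 := by
        have : lin (b u) (t • f) = 0 := by rw [← hvf]; simp [hv, he]
        simpa [ht] using this
      have hef : bilin (a u) e f = 0 := by
        have : bilin (a u) e (t • f) = 0 := by rw [← hvf]; simp [hee]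
        simpa [ht] using this
      obtain ⟨h1, h2⟩ := h.rMat_orthonormal_of_douglas hn hu hD he hf hee hff hef
      have hv' : v = bilin (a u) e v • e + t • f := by rw [← hvf]; abel
      generalize bilin (a u) e v = x at hv'
      subst hv'
      have hfe : bilin (a u) f e = 0 := by rw [bilin_comm (h.metric_symm u hu), hef]
      simp only [map_add, map_smul, LinearMap.add_apply, LinearMap.smul_apply, smul_eq_mul,
        rMat_comm a b u f e, h1, ← h2, hee, hff, hef, hfe]
      ring
  set c := bilin (rMat a b u) e e
  set κ := bilin (rMat a b u) (sharp a b u) (sharp a b u) / m u ^ 2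
  have hself : ∀ y, bilin (rMat a b u) y y = c * bilin (a u) y y
      + (κ - c) / m u ^ 2 * lin (b u) y * lin (b u) y
        - 3 / m u ^ 2 * (bilin (sMat a b u) (sharp a b u) y * lin (b u) y
          + bilin (sMat a b u) (sharp a b u) y * lin (b u) y) := by
    intro y
    rw [h.rMat_self_of_douglas hn hu hD y, key _ (h.lin_sub_smul_sharp hu y)]
    simp only [map_sub, map_smul, LinearMap.sub_apply, LinearMap.smul_apply, smul_eq_mul,
      h.bilin_sharp hu, h.sharp_bilin hu, h.lin_sharp hu, κ]
    field_simp
    ring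
  refine ⟨c, (κ - c) / m u ^ 2, (structureEquations_iff _ _ _ _ _ _).2 fun v w =>
    ⟨?_, h.sMat_of_douglas hn hu hD v w⟩⟩
  have h1 := hself (v + w)
  have h2 := hself v
  have h3 := hself w
  simp only [map_add, LinearMap.add_apply, rMat_comm a b u w v,
    bilin_comm (h.metric_symm u hu) w v] at h1
  linear_combination (h1 - h2 - h3) / 2

end IsLocalModel

end

/-! ### Charts of the manifold as local models -/

section

variable {n : ℕ}

section
variable {X : Type*} [NormedAddCommGroup X] [NormedSpace ℝ X] {U : Set X}

theorem contDiffOn_det {A : X → Matrix (Fin n) (Fin n) ℝ}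
    (hA : ∀ i j, ContDiffOn ℝ ∞ (fun x => A x i j) U) :
    ContDiffOn ℝ ∞ (fun x => (A x).det) U := by
  simp only [Matrix.det_apply, Units.smul_def, zsmul_eq_mul]
  exact ContDiffOn.sum fun σ _ => contDiffOn_const.mul (contDiffOn_prod fun i _ => hA _ _)

theorem contDiffOn_inv {A : X → Matrix (Fin n) (Fin n) ℝ}
    (hA : ∀ i j, ContDiffOn ℝ ∞ (fun x => A x i j) U) (h0 : ∀ x ∈ U, (A x).det ≠ 0)
    (i j : Fin n) : ContDiffOn ℝ ∞ (fun x => (A x)⁻¹ i j) U := by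
  simp only [Matrix.inv_def, Ring.inverse_eq_inv', Matrix.smul_apply, smul_eq_mul,
    Matrix.adjugate_apply]
  refine ((contDiffOn_det hA).inv h0).mul (contDiffOn_det fun p q => ?_)
  simp only [Matrix.updateRow_apply]
  split_ifs
  · exact contDiffOn_const
  · exact hA p q

end

/-- The norm of a linear form. -/
theorem sSup_lin_eq {A : Matrix (Fin n) (Fin n) ℝ} (hA : ∀ i j, A i j = A j i)
    (hpos : ∀ y : Coord n, y ≠ 0 → 0 < bilin A y y) {c : Coord n →ₗ[ℝ] ℝ} {v : Coord n}
    (hc : ∀ w, bilin A w v = c w) (hv : v ≠ 0) :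
    sSup {t : ℝ | ∃ y, √(bilin A y y) ≤ 1 ∧ t = |c y|} = √(c v) := by
  have hvv : 0 < c v := by rw [← hc]; exact hpos v hv
  have hs : 0 < √(c v) := Real.sqrt_pos.2 hvv
  have hs2 := Real.sq_sqrt hvv.le
  refine IsGreatest.csSup_eq ⟨⟨(√(c v))⁻¹ • v, ?_, ?_⟩, ?_⟩
  · have : bilin A ((√(c v))⁻¹ • v) ((√(c v))⁻¹ • v) = 1 := by
      simp only [map_smul, LinearMap.smul_apply, smul_eq_mul, hc]
      field_simp
      exact hs2.symm
    rw [this, Real.sqrt_one]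
  · rw [map_smul, smul_eq_mul, abs_of_pos (by positivity)]
    field_simp
    exact hs2
  · rintro t ⟨y, hy, rfl⟩
    have h1 : bilin A y y ≤ 1 := by
      rwa [Real.sqrt_le_one] at hy
    -- Cauchy-Schwarz, by subtracting from y its projection onto v; the supremum is attained at v
    -- normalised.
    have h2 : 0 ≤ bilin A (y - (c y / c v) • v) (y - (c y / c v) • v) := by
      rcases eq_or_ne (y - (c y / c v) • v) 0 with h | h
      · simp [h]
      · exact (hpos _ h).le
    have h3 : bilin A (y - (c y / c v) • v) (y - (c y / c v) • v) = bilin A y y - c y ^ 2 / c v := by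
      simp only [map_sub, map_smul, LinearMap.sub_apply, LinearMap.smul_apply, smul_eq_mul, hc,
        bilin_comm hA v y]
      field_simp
      ring
    rw [h3, sub_nonneg, div_le_iff₀ hvv] at h2
    refine Real.abs_le_sqrt (h2.trans ?_)
    nlinarith

variable {M : Type*} [TopologicalSpace M] [ChartedSpace (Coord n) M]
  {e : OpenPartialHomeomorph M (Coord n)} {β : (x : M) → TangentSpace (𝓡 n) x →L[ℝ] ℝ}

theorem mdifferentiable_of_mem (he : e ∈ IsManifold.maximalAtlas (𝓡 n) ∞ M) :
    e.MDifferentiable (𝓡 n) (𝓡 n) :=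
  ⟨(contMDiffOn_of_mem_maximalAtlas he).mdifferentiableOn (by simp),
    (contMDiffOn_symm_of_mem_maximalAtlas he).mdifferentiableOn (by simp)⟩

theorem lin_formCoeff (e : OpenPartialHomeomorph M (Coord n)) (u v : Coord n) :
    lin (formCoeff β e u) v = β (e.symm u) (coordVector e u v) := by
  let T : Coord n →ₗ[ℝ] TangentSpace (𝓡 n) (e.symm u) :=
    (mfderiv 𝓘(ℝ, Coord n) (𝓡 n) e.symm u).toLinearMap
  have h1 := map_eq_sum ((β (e.symm u)).toLinearMap.comp T) v
  refine (h1.trans ?_).symm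
  rw [lin_apply]
  exact Finset.sum_congr rfl fun i _ => mul_comm _ _

theorem coordVector_bijective (he : e ∈ IsManifold.maximalAtlas (𝓡 n) ∞ M) {u : Coord n}
    (hu : u ∈ e.target) : Function.Bijective (coordVector e u) :=
  (mdifferentiable_of_mem he).symm.mfderiv_bijective hu

variable [IsManifold (𝓡 n) ∞ M]

theorem contMDiff_const_vector (y : Coord n) :
    ContMDiff (𝓡 n) ((𝓡 n).prod 𝓘(ℝ, Coord n)) ∞
      (fun u : Coord n => (⟨u, y⟩ : TangentBundle (𝓡 n) (Coord n))) := by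
  intro u
  rw [Bundle.contMDiffAt_totalSpace]
  refine ⟨contMDiffAt_id, ?_⟩
  simp
  exact contMDiffAt_const

theorem contMDiffOn_coordVector (he : e ∈ IsManifold.maximalAtlas (𝓡 n) ∞ M) (y : Coord n) :
    ContMDiffOn (𝓡 n) ((𝓡 n).prod 𝓘(ℝ, Coord n)) ∞
      (fun u : Coord n => (⟨e.symm u, coordVector e u y⟩ : TangentBundle (𝓡 n) M)) e.target := by
  have h := (contMDiffOn_symm_of_mem_maximalAtlas he).contMDiffOn_tangentMapWithin (m := ∞)
    (by simp) e.open_target.uniqueMDiffOn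
  have h2 := h.comp (contMDiff_const_vector y).contMDiffOn (s := e.target) (fun u hu => hu)
  refine h2.congr fun u hu => ?_
  simp [tangentMapWithin, coordVector, mfderivWithin_of_isOpen e.open_target hu]

variable (g : Bundle.ContMDiffRiemannianMetric (𝓡 n) ∞ (Coord n) (fun x : M => TangentSpace (𝓡 n) x))

theorem contDiffOn_formCoeff (hβ : IsSmoothForm β) (he : e ∈ IsManifold.maximalAtlas (𝓡 n) ∞ M)
    (i : Fin n) : ContDiffOn ℝ ∞ (fun u => formCoeff β e u i) e.target := by
  rw [← contMDiffOn_iff_contDiffOn]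
  intro u hu
  have hs := (contMDiffOn_symm_of_mem_maximalAtlas he) u hu
  have : ContMDiffWithinAt (𝓡 n) ((𝓡 n).prod 𝓘(ℝ)) ∞
      (fun u ↦ Bundle.TotalSpace.mk' ℝ (E := Bundle.Trivial M ℝ) (e.symm u)
        (formCoeff β e u i)) e.target u := by
    apply ContMDiffWithinAt.clm_bundle_apply (F₁ := Coord n) (E₁ := fun x : M => TangentSpace (𝓡 n) x)
    · exact ContMDiffAt.comp_contMDiffWithinAt u hβ.contMDiffAt hs
    · exact contMDiffOn_coordVector he _ u hu
  simp only [Bundle.contMDiffWithinAt_totalSpace] at this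
  exact this.2

theorem contDiffOn_metricCoeff (he : e ∈ IsManifold.maximalAtlas (𝓡 n) ∞ M)
    (i j : Fin n) : ContDiffOn ℝ ∞ (fun u => metricCoeff g e u i j) e.target := by
  rw [← contMDiffOn_iff_contDiffOn]
  intro u hu
  have hs := (contMDiffOn_symm_of_mem_maximalAtlas he) u hu
  have : ContMDiffWithinAt (𝓡 n) ((𝓡 n).prod 𝓘(ℝ)) ∞
      (fun u ↦ Bundle.TotalSpace.mk' ℝ (E := Bundle.Trivial M ℝ) (e.symm u)
        (metricCoeff g e u i j)) e.target u := by
    apply ContMDiffWithinAt.clm_bundle_apply₂ (F₁ := Coord n) (F₂ := Coord n)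
      (E₁ := fun x : M => TangentSpace (𝓡 n) x) (E₂ := fun x : M => TangentSpace (𝓡 n) x)
    · exact ContMDiffAt.comp_contMDiffWithinAt u g.contMDiff.contMDiffAt hs
    · exact contMDiffOn_coordVector he _ u hu
    · exact contMDiffOn_coordVector he _ u hu
  simp only [Bundle.contMDiffWithinAt_totalSpace] at this
  exact this.2

theorem bilin_metricCoeff (e : OpenPartialHomeomorph M (Coord n)) (u v w : Coord n) :
    bilin (metricCoeff g e u) v w = g.inner (e.symm u) (coordVector e u v) (coordVector e u w) := by
  let T : Coord n →ₗ[ℝ] TangentSpace (𝓡 n) (e.symm u) :=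
    (mfderiv 𝓘(ℝ, Coord n) (𝓡 n) e.symm u).toLinearMap
  exact bilin_eq_of_single (LinearMap.mk₂ ℝ (fun v w => g.inner (e.symm u) (T v) (T w))
    (by simp) (by simp) (by simp) (by simp)) (fun i j => rfl) v w

/-- The bridge to coordinates: the supremum defining the norm equals √(a^{ij} b_i b_j). This is
positive because β does not vanish, hence smooth in the chart. -/
theorem isLocalModel (hβ : IsSmoothForm β) (hβ0 : ∀ x, β x ≠ 0)
    (he : e ∈ IsManifold.maximalAtlas (𝓡 n) ∞ M) :
    IsLocalModel (localExpr (singularSquareMetric g β) e) (metricCoeff g e) (formCoeff β e)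
      (fun u => formNorm g β (e.symm u)) e.target := by
  have hsymm : ∀ u ∈ e.target, ∀ i j, metricCoeff g e u i j = metricCoeff g e u j i :=
    fun u _ i j => g.symm _ _ _
  have hpos : ∀ u ∈ e.target, ∀ y ≠ 0, 0 < bilin (metricCoeff g e u) y y := by
    intro u hu y hy
    rw [bilin_metricCoeff]
    refine g.pos _ _ fun h0 => hy ((coordVector_bijective he hu).1 ?_)
    rw [h0]
    exact (map_zero (mfderiv 𝓘(ℝ, Coord n) (𝓡 n) e.symm u)).symm
  have hsharp : ∀ u ∈ e.target, ∀ w, bilin (metricCoeff g e u) w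
      (sharp (metricCoeff g e) (formCoeff β e) u) = lin (formCoeff β e u) w := fun u hu w =>
    bilin_inv_mulVec (isUnit_det_of_pos (hpos u hu)) _ w
  have hsharp0 : ∀ u ∈ e.target, sharp (metricCoeff g e) (formCoeff β e) u ≠ 0 := by
    intro u hu h0
    refine hβ0 (e.symm u) (ContinuousLinearMap.ext fun v => ?_)
    obtain ⟨y, rfl⟩ := (coordVector_bijective he hu).2 v
    rw [← lin_formCoeff, ← hsharp u hu, h0]
    simp
  have hnorm : ∀ u ∈ e.target, formNorm g β (e.symm u) =
      √(lin (formCoeff β e u) (sharp (metricCoeff g e) (formCoeff β e) u)) := by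
    intro u hu
    rw [← sSup_lin_eq (hsymm u hu) (hpos u hu) (hsharp u hu) (hsharp0 u hu), formNorm]
    congr 1
    ext t
    constructor
    · rintro ⟨v, hv, rfl⟩
      obtain ⟨y, rfl⟩ := (coordVector_bijective he hu).2 v
      exact ⟨y, by rwa [bilin_metricCoeff], by rw [lin_formCoeff]⟩
    · rintro ⟨y, hy, rfl⟩
      exact ⟨coordVector e u y, by rwa [bilin_metricCoeff] at hy, by rw [lin_formCoeff]⟩
  have hβpos : ∀ u ∈ e.target,
      0 < lin (formCoeff β e u) (sharp (metricCoeff g e) (formCoeff β e) u) := fun u hu => by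
    rw [← hsharp u hu]; exact hpos u hu _ (hsharp0 u hu)
  refine ⟨e.open_target, contDiffOn_metricCoeff g he, contDiffOn_formCoeff hβ he, ?_, hsymm, hpos,
    fun u hu => ?_, fun u hu => ?_, fun u hu y => ?_⟩
  · refine ContDiffOn.congr (ContDiffOn.sqrt ?_ fun u hu => (hβpos u hu).ne') hnorm
    simp only [lin_apply, sharp, raised]
    exact ContDiffOn.sum fun i _ => (contDiffOn_formCoeff hβ he i).mul
      (ContDiffOn.sum fun j _ => (contDiffOn_inv (contDiffOn_metricCoeff g he)
        (fun u hu => (isUnit_det_of_pos (hpos u hu)).ne_zero) i j).mul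
          (contDiffOn_formCoeff hβ he j))
  · simp only [hnorm u hu]
    exact Real.sqrt_pos.2 (hβpos u hu)
  · simp only [hnorm u hu]
    exact Real.sq_sqrt (hβpos u hu).le
  · rw [localExpr, singularSquareMetric, alpha, bilin_metricCoeff, lin_formCoeff]

end

/-! ### Formulas for c and d, and the tensor property of r_ij -/

section

variable {n : ℕ}

/-- The function `c`, in terms of `a^{ij} r_ij` and `r_ij b^i b^j`. -/
def coeffC (a : Coord n → Matrix (Fin n) (Fin n) ℝ) (b : Coord n → Fin n → ℝ) (m : Coord n → ℝ)
    (u : Coord n) : ℝ :=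
  (∑ i, ∑ j, (a u)⁻¹ i j * rTensor a b i j u
    - bilin (rMat a b u) (sharp a b u) (sharp a b u) / m u ^ 2) / (n - 1)

/-- The function `d`, in terms of `a^{ij} r_ij` and `r_ij b^i b^j`. -/
def coeffD (a : Coord n → Matrix (Fin n) (Fin n) ℝ) (b : Coord n → Fin n → ℝ) (m : Coord n → ℝ)
    (u : Coord n) : ℝ :=
  (bilin (rMat a b u) (sharp a b u) (sharp a b u) / m u ^ 2 - coeffC a b m u) / m u ^ 2

namespace IsLocalModel
variable {L : Coord n → Coord n → ℝ} {a : Coord n → Matrix (Fin n) (Fin n) ℝ}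
  {b : Coord n → Fin n → ℝ} {m : Coord n → ℝ} {U : Set (Coord n)} {u y : Coord n}

theorem rMat_sharp_sharp (h : IsLocalModel L a b m U) (hu : u ∈ U) {c d : ℝ}
    (hS : StructureEquations a b (m u) c d u) :
    bilin (rMat a b u) (sharp a b u) (sharp a b u) = c * m u ^ 2 + d * m u ^ 4 := by
  rw [((structureEquations_iff a b (m u) c d u).1 hS _ _).1, bilin_sMat_self, h.bilin_sharp hu,
    h.lin_sharp hu]
  ring

/-- Since s_i b^i = 0, the structure equations give a^{ij} r_ij = nc + d b² and r_ij b^i b^j = c b²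
+ d b⁴. This linear system determines c and d. -/
theorem eq_coeff (hn : 3 ≤ n) (h : IsLocalModel L a b m U) (hu : u ∈ U) {c d : ℝ}
    (hS : StructureEquations a b (m u) c d u) : c = coeffC a b m u ∧ d = coeffD a b m u := by
  have hm0 := h.norm_pos u hu
  have hn' : (n : ℝ) - 1 ≠ 0 := by
    have : (3 : ℝ) ≤ n := by exact_mod_cast hn
    linarith
  have hdet := isUnit_det_of_pos (h.metric_pos u hu)
  have hsymm : ∀ i j, (a u)⁻¹ i j = (a u)⁻¹ j i := by
    intro i j
    have : (a u).transpose = a u := Matrix.ext fun i j => h.metric_symm u hu j i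
    have := Matrix.transpose_nonsing_inv (a u)
    rw [‹(a u).transpose = a u›] at this
    exact congrFun (congrFun this j) i
  have h1 : ∑ i, ∑ j, (a u)⁻¹ i j * a u i j = n := by
    have : ((a u)⁻¹ * a u).trace = n := by simp [Matrix.nonsing_inv_mul _ hdet]
    rw [← this]
    simp only [Matrix.trace, Matrix.diag, Matrix.mul_apply]
    exact Finset.sum_congr rfl fun i _ => Finset.sum_congr rfl fun j _ => by
      rw [h.metric_symm u hu i j]
  have h2 : ∀ c : Fin n → ℝ, ∑ i, ∑ j, (a u)⁻¹ i j * (c i * b u j) = lin c (sharp a b u) := by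
    intro c
    rw [lin_apply]
    refine Finset.sum_congr rfl fun i _ => ?_
    simp only [sharp, raised, Finset.mul_sum]
    exact Finset.sum_congr rfl fun j _ => by ring
  have h3 : ∑ i, ∑ j, (a u)⁻¹ i j * (sForm a b i u * b u j) = 0 := by
    rw [h2 fun i => sForm a b i u, lin_sForm, bilin_sMat_self]
  have h4 : ∑ i, ∑ j, (a u)⁻¹ i j * (sForm a b j u * b u i) = 0 := by
    rw [← h3, Finset.sum_comm]
    exact Finset.sum_congr rfl fun i _ => Finset.sum_congr rfl fun j _ => by rw [hsymm]
  have htr : ∑ i, ∑ j, (a u)⁻¹ i j * rTensor a b i j u = c * n + d * m u ^ 2 := by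
    have : ∀ i j, (a u)⁻¹ i j * rTensor a b i j u = c * ((a u)⁻¹ i j * a u i j)
        + d * ((a u)⁻¹ i j * (b u i * b u j)) - 3 / m u ^ 2 *
          ((a u)⁻¹ i j * (sForm a b i u * b u j))
          - 3 / m u ^ 2 * ((a u)⁻¹ i j * (sForm a b j u * b u i)) := by
      intro i j
      rw [(hS i j).1]
      ring
    simp only [this, Finset.sum_add_distrib, Finset.sum_sub_distrib, ← Finset.mul_sum]
    rw [h1, h2, h3, h4, h.lin_sharp hu]
    ring
  have hc : c = coeffC a b m u := by
    rw [coeffC, htr, h.rMat_sharp_sharp hu hS]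
    field_simp
    ring
  refine ⟨hc, ?_⟩
  rw [coeffD, ← hc, h.rMat_sharp_sharp hu hS]
  field_simp
  ring

theorem contDiffOn_metric_inv (h : IsLocalModel L a b m U) (i j : Fin n) :
    ContDiffOn ℝ ∞ (fun u => (a u)⁻¹ i j) U :=
  contDiffOn_inv h.metric_smooth (fun u hu => (isUnit_det_of_pos (h.metric_pos u hu)).ne_zero) i j

theorem contDiffOn_rTensor (h : IsLocalModel L a b m U) (i j : Fin n) :
    ContDiffOn ℝ ∞ (fun u => rTensor a b i j u) U := by
  have hg : ∀ k i j, ContDiffOn ℝ ∞ (fun u => christoffel a k i j u) U := fun k i j =>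
    contDiffOn_const.mul (ContDiffOn.sum fun l _ => (h.contDiffOn_metric_inv k l).mul
      (((contDiffOn_pd (h.metric_smooth l j) h.isOpen i).add
        (contDiffOn_pd (h.metric_smooth l i) h.isOpen j)).sub
          (contDiffOn_pd (h.metric_smooth i j) h.isOpen l)))
  have hb : ∀ i j, ContDiffOn ℝ ∞ (fun u => covDeriv a b i j u) U := fun i j =>
    (contDiffOn_pd (h.form_smooth i) h.isOpen j).sub
      (ContDiffOn.sum fun k _ => (hg k i j).mul (h.form_smooth k))
  exact contDiffOn_const.mul ((hb i j).add (hb j i))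

theorem contDiffOn_rMat_sharp (h : IsLocalModel L a b m U) :
    ContDiffOn ℝ ∞ (fun u => bilin (rMat a b u) (sharp a b u) (sharp a b u)) U := by
  have hs : ∀ i, ContDiffOn ℝ ∞ (fun u => raised a b i u) U := fun i =>
    ContDiffOn.sum fun j _ => (h.contDiffOn_metric_inv i j).mul (h.form_smooth j)
  simp only [bilin_apply, rMat, Matrix.of_apply, sharp]
  exact ContDiffOn.sum fun i _ => ContDiffOn.sum fun j _ =>
    ((h.contDiffOn_rTensor i j).mul (hs i)).mul (hs j)

theorem contDiffOn_coeffC (h : IsLocalModel L a b m U) : ContDiffOn ℝ ∞ (coeffC a b m) U := by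
  refine ((ContDiffOn.sum fun i _ => ContDiffOn.sum fun j _ =>
    (h.contDiffOn_metric_inv i j).mul (h.contDiffOn_rTensor i j)).sub
      (h.contDiffOn_rMat_sharp.div (h.norm_smooth.pow 2) fun u hu => ?_)).div_const _
  exact pow_ne_zero 2 (h.norm_pos u hu).ne'

theorem contDiffOn_coeffD (h : IsLocalModel L a b m U) : ContDiffOn ℝ ∞ (coeffD a b m) U := by
  have h0 : ∀ u ∈ U, m u ^ 2 ≠ 0 := fun u hu => pow_ne_zero 2 (h.norm_pos u hu).ne'
  exact ((h.contDiffOn_rMat_sharp.div (h.norm_smooth.pow 2) h0).sub h.contDiffOn_coeffC).div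
    (h.norm_smooth.pow 2) h0

end IsLocalModel

section
variable {X : Type*} [NormedAddCommGroup X] [NormedSpace ℝ X] {x : X}

theorem hasFDerivAt_bilin_comp {A : X → Matrix (Fin n) (Fin n) ℝ} {V W : X → Coord n}
    {A' : Fin n → Fin n → X →L[ℝ] ℝ} {V' W' : X →L[ℝ] Coord n}
    (hA : ∀ i j, HasFDerivAt (fun x => A x i j) (A' i j) x) (hV : HasFDerivAt V V' x)
    (hW : HasFDerivAt W W' x) : ∃ f' : X →L[ℝ] ℝ,
      HasFDerivAt (fun x => bilin (A x) (V x) (W x)) f' x ∧ ∀ z, f' z =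
        bilin (Matrix.of fun i j => A' i j z) (V x) (W x) + bilin (A x) (V' z) (W x)
          + bilin (A x) (V x) (W' z) := by
  have hc : ∀ {V : X → Coord n} {V' : X →L[ℝ] Coord n}, HasFDerivAt V V' x → ∀ i,
      HasFDerivAt (fun x => V x i) ((EuclideanSpace.proj i : Coord n →L[ℝ] ℝ).comp V') x :=
    fun hV i => (EuclideanSpace.proj i : Coord n →L[ℝ] ℝ).hasFDerivAt.comp x hV
  have h := HasFDerivAt.fun_sum (u := Finset.univ) fun i _ =>
    HasFDerivAt.fun_sum (u := Finset.univ) fun j _ =>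
      ((hA i j).fun_mul (hc hV i)).fun_mul (hc hW j)
  simp only [← bilin_apply] at h
  refine ⟨_, h, fun z => ?_⟩
  simp only [bilin_apply, sum_apply, ← Finset.sum_add_distrib]
  exact Finset.sum_congr rfl fun i _ => Finset.sum_congr rfl fun j _ => by simp; ring

theorem hasFDerivAt_lin_comp {c : X → Fin n → ℝ} {V : X → Coord n}
    {c' : Fin n → X →L[ℝ] ℝ} {V' : X →L[ℝ] Coord n}
    (hA : ∀ i, HasFDerivAt (fun x => c x i) (c' i) x) (hV : HasFDerivAt V V' x) :
    ∃ f' : X →L[ℝ] ℝ, HasFDerivAt (fun x => lin (c x) (V x)) f' x ∧ ∀ z, f' z =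
        lin (fun i => c' i z) (V x) + lin (c x) (V' z) := by
  have hc : ∀ i, HasFDerivAt (fun x => V x i)
      ((EuclideanSpace.proj i : Coord n →L[ℝ] ℝ).comp V') x :=
    fun i => (EuclideanSpace.proj i : Coord n →L[ℝ] ℝ).hasFDerivAt.comp x hV
  have h := HasFDerivAt.fun_sum (u := Finset.univ) fun i _ => (hA i).fun_mul (hc i)
  simp only [← lin_apply] at h
  refine ⟨_, h, fun z => ?_⟩
  simp only [lin_apply, sum_apply, ← Finset.sum_add_distrib]
  exact Finset.sum_congr rfl fun i _ => by simp; ring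

end

namespace IsLocalModel
variable {L L' : Coord n → Coord n → ℝ} {a a' : Coord n → Matrix (Fin n) (Fin n) ℝ}
  {b b' : Coord n → Fin n → ℝ} {m m' : Coord n → ℝ} {U U' : Set (Coord n)} {u : Coord n}
  {φ : Coord n → Coord n}

/-- Only first derivatives of a_ij and b_i and the vector b^i occur. In this form the second
derivatives of a coordinate change visibly cancel, by their symmetry and a(b^i, ·) = β. -/
theorem rMat_self_eq (h : IsLocalModel L a b m U) (hu : u ∈ U) (v : Coord n) :
    bilin (rMat a b u) v v = lin (dVec b u v) v - bilin (dMat a u v) (sharp a b u) v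
      + bilin (dMat a u (sharp a b u)) v v / 2 := by
  rw [bilin_rMat, bilin_covMat, ← h.bilin_sharp hu, bilin_comm (h.metric_symm u hu),
    h.bilin_christoffelVec hu]
  ring

/-- A change of coordinates maps the vectors `b^i` to each other. -/
theorem fderiv_sharp (h : IsLocalModel L a b m U) (h' : IsLocalModel L' a' b' m' U') (hu : u ∈ U)
    (hu' : φ u ∈ U') (hJ : Function.Surjective (fderiv ℝ φ u))
    (ha : ∀ v w, bilin (a u) v w = bilin (a' (φ u)) (fderiv ℝ φ u v) (fderiv ℝ φ u w))
    (hb : ∀ v, lin (b u) v = lin (b' (φ u)) (fderiv ℝ φ u v)) :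
    fderiv ℝ φ u (sharp a b u) = sharp a' b' (φ u) := by
  rw [← sub_eq_zero]
  refine h'.eq_zero_of_forall_bilin hu' fun w => ?_
  obtain ⟨w, rfl⟩ := hJ w
  rw [map_sub, ← ha, h.bilin_sharp hu, h'.bilin_sharp hu', hb, sub_self]

/-- Under a change of coordinates `r_ij` transforms as a tensor. -/
theorem rMat_self_transform (h : IsLocalModel L a b m U) (h' : IsLocalModel L' a' b' m' U')
    (hu : u ∈ U) (hu' : φ u ∈ U') (hφ : ContDiffAt ℝ 2 φ u)
    (hJ : Function.Surjective (fderiv ℝ φ u))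
    (ha : ∀ᶠ z in 𝓝 u, ∀ v w,
      bilin (a z) v w = bilin (a' (φ z)) (fderiv ℝ φ z v) (fderiv ℝ φ z w))
    (hb : ∀ᶠ z in 𝓝 u, ∀ v, lin (b z) v = lin (b' (φ z)) (fderiv ℝ φ z v)) (v : Coord n) :
    bilin (rMat a b u) v v = bilin (rMat a' b' (φ u)) (fderiv ℝ φ u v) (fderiv ℝ φ u v) := by
  have hφ1 := (hφ.differentiableAt (by simp)).hasFDerivAt
  have hφ2 : HasFDerivAt (fderiv ℝ φ) (fderiv ℝ (fderiv ℝ φ) u) u :=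
    ((hφ.fderiv_right (m := 1) (by norm_num)).differentiableAt (by simp)).hasFDerivAt
  have hsym : ∀ v w, fderiv ℝ (fderiv ℝ φ) u v w = fderiv ℝ (fderiv ℝ φ) u w v :=
    (hφ.isSymmSndFDerivAt (by simp)).eq
  have hV : ∀ v, HasFDerivAt (fun z => fderiv ℝ φ z v)
      ((ContinuousLinearMap.apply ℝ (Coord n) v).comp (fderiv ℝ (fderiv ℝ φ) u)) u := fun v =>
    (ContinuousLinearMap.apply ℝ (Coord n) v).hasFDerivAt.comp u hφ2
  have hdA : ∀ z v w, bilin (dMat a u z) v w =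
      bilin (dMat a' (φ u) (fderiv ℝ φ u z)) (fderiv ℝ φ u v) (fderiv ℝ φ u w)
        + bilin (a' (φ u)) (fderiv ℝ (fderiv ℝ φ) u z v) (fderiv ℝ φ u w)
        + bilin (a' (φ u)) (fderiv ℝ φ u v) (fderiv ℝ (fderiv ℝ φ) u z w) := by
    intro z v w
    obtain ⟨f, hf, hf'⟩ := hasFDerivAt_bilin (h.metric_diff hu) v w
    obtain ⟨k, hk, hk'⟩ := hasFDerivAt_bilin_comp (A := fun z => a' (φ z)) (fun i j =>
      (h'.metric_diff hu' i j).hasFDerivAt.comp u hφ1) (hV v) (hV w)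
    have := hf.unique (hk.congr_of_eventuallyEq (ha.mono fun z hz => hz v w))
    rw [← hf', this, hk']
    rfl
  have hdB : ∀ z v, lin (dVec b u z) v =
      lin (dVec b' (φ u) (fderiv ℝ φ u z)) (fderiv ℝ φ u v)
        + lin (b' (φ u)) (fderiv ℝ (fderiv ℝ φ) u z v) := by
    intro z v
    obtain ⟨f, hf, hf'⟩ := hasFDerivAt_lin (h.form_diff hu) v
    obtain ⟨k, hk, hk'⟩ := hasFDerivAt_lin_comp (c := fun z => b' (φ z)) (fun i =>
      (h'.form_diff hu' i).hasFDerivAt.comp u hφ1) (hV v)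
    have := hf.unique (hk.congr_of_eventuallyEq (hb.mono fun z hz => hz v))
    rw [← hf', this, hk']
    rfl
  rw [h.rMat_self_eq hu, h'.rMat_self_eq hu', hdA, hdA, hdB,
    h.fderiv_sharp h' hu hu' hJ ha.self_of_nhds hb.self_of_nhds, h'.sharp_bilin hu',
    hsym (sharp a b u) v,
    bilin_comm (h'.metric_symm _ hu') (fderiv ℝ φ u v)]
  ring

/-- Both coefficients are values of the tensor r_ij: on a vector annihilated by β it reduces to c
a(v, v), and on b^i it is c b² + d b⁴. -/
theorem structureEquations_unique (hn : 3 ≤ n) (h : IsLocalModel L a b m U)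
    (h' : IsLocalModel L' a' b' m' U') (hu : u ∈ U) (hu' : φ u ∈ U') (hφ : ContDiffAt ℝ 2 φ u)
    (hJ : Function.Bijective (fderiv ℝ φ u))
    (ha : ∀ᶠ z in 𝓝 u, ∀ v w,
      bilin (a z) v w = bilin (a' (φ z)) (fderiv ℝ φ z v) (fderiv ℝ φ z w))
    (hb : ∀ᶠ z in 𝓝 u, ∀ v, lin (b z) v = lin (b' (φ z)) (fderiv ℝ φ z v)) {c d c' d' : ℝ}
    (hS : StructureEquations a b (m u) c d u)
    (hS' : StructureEquations a' b' (m' (φ u)) c' d' (φ u)) : c = c' ∧ d = d' := by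
  have hr := h.rMat_self_transform h' hu hu' hφ hJ.2 ha hb
  have ha0 := ha.self_of_nhds
  have hb0 := hb.self_of_nhds
  have hs := h.fderiv_sharp h' hu hu' hJ.2 ha0 hb0
  have hm : m u ^ 2 = m' (φ u) ^ 2 := by
    rw [h.norm_sq u hu, h'.norm_sq _ hu', hb0, hs]
  have hc : c = c' := by
    obtain ⟨v, hv0, hv, -⟩ := exists_ne_zero_of_two_forms hn (lin (b u)) (lin (b u))
    have hvv := h.metric_pos u hu v hv0
    have hv' : lin (b' (φ u)) (fderiv ℝ φ u v) = 0 := by rw [← hb0, hv]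
    have := hr v
    rw [((structureEquations_iff _ _ _ _ _ _).1 hS v v).1,
      ((structureEquations_iff _ _ _ _ _ _).1 hS' _ _).1, hv, hv', ← ha0] at this
    exact mul_right_cancel₀ hvv.ne' (by linear_combination this)
  refine ⟨hc, ?_⟩
  have := hr (sharp a b u)
  rw [hs, h.rMat_sharp_sharp hu hS, h'.rMat_sharp_sharp hu' hS', ← hc, ← hm,
    show m' (φ u) ^ 4 = m u ^ 4 by linear_combination (-(m u ^ 2) - m' (φ u) ^ 2) * hm] at this
  exact mul_right_cancel₀ (pow_pos (h.norm_pos u hu) 4).ne' (by linear_combination this)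

end IsLocalModel

end

/-! ### Changes of coordinates and the global statement -/

section

variable {n : ℕ} {M : Type*} [TopologicalSpace M] [ChartedSpace (Coord n) M]
  {e e' : OpenPartialHomeomorph M (Coord n)} {u : Coord n}

theorem contDiffAt_coordChange (he : e ∈ IsManifold.maximalAtlas (𝓡 n) ∞ M)
    (he' : e' ∈ IsManifold.maximalAtlas (𝓡 n) ∞ M) (hu : u ∈ e.target)
    (hu' : e.symm u ∈ e'.source) : ContDiffAt ℝ ∞ (fun z => e' (e.symm z)) u := by
  rw [← contMDiffAt_iff_contDiffAt]
  exact (contMDiffAt_of_mem_maximalAtlas he' hu').comp u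
    (contMDiffAt_symm_of_mem_maximalAtlas he hu)

/-- The transformation law of the components of a tangent vector. -/
theorem coordVector_coordChange (he : e ∈ IsManifold.maximalAtlas (𝓡 n) ∞ M)
    (he' : e' ∈ IsManifold.maximalAtlas (𝓡 n) ∞ M) (hu : u ∈ e.target)
    (hu' : e.symm u ∈ e'.source) (y : Coord n) :
    (coordVector e u y : Coord n) =
      coordVector e' (e' (e.symm u)) (fderiv ℝ (fun z => e' (e.symm z)) u y) := by
  have hev : ∀ᶠ z in 𝓝 u, e.symm z = (e'.symm ∘ fun z => e' (e.symm z)) z := by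
    filter_upwards [(e.continuousAt_symm hu).preimage_mem_nhds (e'.open_source.mem_nhds hu')]
      with z hz
    exact (e'.left_inv hz).symm
  have h1 := Filter.EventuallyEq.mfderiv_eq (I := 𝓘(ℝ, Coord n)) (I' := 𝓡 n) hev
  have h2 := mfderiv_comp (I := 𝓘(ℝ, Coord n)) (I' := 𝓘(ℝ, Coord n)) (I'' := 𝓡 n) u
    ((mdifferentiable_of_mem he').symm.mdifferentiableAt (e'.map_source hu'))
    (((contDiffAt_coordChange he he' hu hu').differentiableAt (by simp)).mdifferentiableAt)
  rw [mfderiv_eq_fderiv] at h2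
  exact congrArg (fun T : Coord n →L[ℝ] Coord n => T y) (h1.trans h2)

theorem bijective_fderiv_coordChange (he : e ∈ IsManifold.maximalAtlas (𝓡 n) ∞ M)
    (he' : e' ∈ IsManifold.maximalAtlas (𝓡 n) ∞ M) (hu : u ∈ e.target)
    (hu' : e.symm u ∈ e'.source) :
    Function.Bijective (fderiv ℝ (fun z => e' (e.symm z)) u) := by
  have h1 : Function.Bijective (fun y => (coordVector e u y : Coord n)) :=
    coordVector_bijective he hu
  have h2 : Function.Bijective (fun y => (coordVector e' (e' (e.symm u)) y : Coord n)) :=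
    coordVector_bijective he' (e'.map_source hu')
  have h3 : (fun y => (coordVector e u y : Coord n)) =
      (fun y => (coordVector e' (e' (e.symm u)) y : Coord n)) ∘ fderiv ℝ (fun z => e' (e.symm z)) u :=
    funext fun y => coordVector_coordChange he he' hu hu' y
  exact (Function.Bijective.of_comp_iff' h2 _).1 (h3 ▸ h1)

variable {β : (x : M) → TangentSpace (𝓡 n) x →L[ℝ] ℝ}

theorem formCoeff_coordChange (he : e ∈ IsManifold.maximalAtlas (𝓡 n) ∞ M)
    (he' : e' ∈ IsManifold.maximalAtlas (𝓡 n) ∞ M) (hu : u ∈ e.target)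
    (hu' : e.symm u ∈ e'.source) (v : Coord n) :
    lin (formCoeff β e u) v = lin (formCoeff β e' (e' (e.symm u)))
      (fderiv ℝ (fun z => e' (e.symm z)) u v) := by
  -- The base points `e.symm u` and `e'.symm (e' (e.symm u))` are only propositionally equal, so the
  -- form is transported with all tangent spaces read as the fixed model space.
  have key : ∀ x x' : M, x = x' → ∀ p : Coord n, (β x p : ℝ) = β x' p := by
    rintro x _ rfl p
    rfl
  rw [lin_formCoeff, lin_formCoeff]
  refine Eq.trans ?_ (key _ _ (e'.left_inv hu').symm _)
  exact congrArg (fun p : Coord n => (β (e.symm u) p : ℝ))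
    (coordVector_coordChange he he' hu hu' v)

variable [IsManifold (𝓡 n) ∞ M]
variable (g : Bundle.ContMDiffRiemannianMetric (𝓡 n) ∞ (Coord n) (fun x : M => TangentSpace (𝓡 n) x))

theorem metricCoeff_coordChange (he : e ∈ IsManifold.maximalAtlas (𝓡 n) ∞ M)
    (he' : e' ∈ IsManifold.maximalAtlas (𝓡 n) ∞ M) (hu : u ∈ e.target)
    (hu' : e.symm u ∈ e'.source) (v w : Coord n) :
    bilin (metricCoeff g e u) v w = bilin (metricCoeff g e' (e' (e.symm u)))
      (fderiv ℝ (fun z => e' (e.symm z)) u v) (fderiv ℝ (fun z => e' (e.symm z)) u w) := by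
  have key : ∀ x x' : M, x = x' → ∀ p q : Coord n, (g.inner x p q : ℝ) = g.inner x' p q := by
    rintro x _ rfl p q
    rfl
  rw [bilin_metricCoeff, bilin_metricCoeff]
  refine Eq.trans ?_ (key _ _ (e'.left_inv hu').symm _ _)
  have hv := coordVector_coordChange he he' hu hu' v
  have hw := coordVector_coordChange he he' hu hu' w
  exact congrArg₂ (fun p q : Coord n => (g.inner (e.symm u) p q : ℝ)) hv hw

theorem coeff_coordChange (hn : 3 ≤ n) (hβ : IsSmoothForm β) (hβ0 : ∀ x, β x ≠ 0)
    (he : e ∈ IsManifold.maximalAtlas (𝓡 n) ∞ M)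
    (he' : e' ∈ IsManifold.maximalAtlas (𝓡 n) ∞ M) (hu : u ∈ e.target)
    (hu' : e.symm u ∈ e'.source) {c d c' d' : ℝ}
    (hS : StructureEquations (metricCoeff g e) (formCoeff β e) (formNorm g β (e.symm u)) c d u)
    (hS' : StructureEquations (metricCoeff g e') (formCoeff β e') (formNorm g β (e.symm u)) c' d'
      (e' (e.symm u))) : c = c' ∧ d = d' := by
  have hev : ∀ᶠ z in 𝓝 u, z ∈ e.target ∧ e.symm z ∈ e'.source :=
    Filter.Eventually.and (e.open_target.mem_nhds hu)
      ((e.continuousAt_symm hu).preimage_mem_nhds (e'.open_source.mem_nhds hu'))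
  refine (isLocalModel g hβ hβ0 he).structureEquations_unique hn (isLocalModel g hβ hβ0 he') hu
    (e'.map_source hu') ((contDiffAt_coordChange he he' hu hu').of_le (WithTop.coe_le_coe.2 le_top))
    (bijective_fderiv_coordChange he he' hu hu')
    (hev.mono fun z hz => metricCoeff_coordChange g he he' hz.1 hz.2)
    (hev.mono fun z hz => formCoeff_coordChange he he' hz.1 hz.2) hS ?_
  simpa only [e'.left_inv hu'] using hS'

/-- The values of c and d at x are chosen in the preferred chart at x. Uniqueness carries the
equations to every chart, and within one chart c and d agree with `coeffC` and `coeffD`, so the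
pointwise choice is smooth. -/
theorem IsDouglas.exists_structureEquations (hn : 3 ≤ n) (hβ : IsSmoothForm β)
    (hβ0 : ∀ x, β x ≠ 0) (hF : IsDouglas (singularSquareMetric g β)) :
    ∃ c d : M → ℝ, ContMDiff (𝓡 n) 𝓘(ℝ) ∞ c ∧ ContMDiff (𝓡 n) 𝓘(ℝ) ∞ d ∧
      ∀ e ∈ IsManifold.maximalAtlas (𝓡 n) ∞ M, ∀ u ∈ e.target,
        StructureEquations (metricCoeff g e) (formCoeff β e) (formNorm g β (e.symm u))
          (c (e.symm u)) (d (e.symm u)) u := by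
  have hpoint : ∀ e ∈ IsManifold.maximalAtlas (𝓡 n) ∞ M, ∀ x ∈ e.source, ∃ c d,
      StructureEquations (metricCoeff g e) (formCoeff β e) (formNorm g β x) c d (e x) := by
    intro e he x hx
    obtain ⟨c, d, h⟩ := (isLocalModel g hβ hβ0 he).exists_structureEquations hn
      (e.map_source hx) (fun y hy hdet => hF e he _ (e.map_source hx) y hy hdet)
    exact ⟨c, d, by simpa only [e.left_inv hx] using h⟩
  choose c d hcd using fun x : M => hpoint (chartAt (Coord n) x)
    (IsManifold.chart_mem_maximalAtlas x) x (mem_chart_source (Coord n) x)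
  have hS : ∀ e ∈ IsManifold.maximalAtlas (𝓡 n) ∞ M, ∀ u ∈ e.target,
      StructureEquations (metricCoeff g e) (formCoeff β e) (formNorm g β (e.symm u))
        (c (e.symm u)) (d (e.symm u)) u := by
    intro e he u hu
    obtain ⟨c', d', h⟩ := hpoint e he _ (e.map_target hu)
    rw [e.right_inv hu] at h
    obtain ⟨rfl, rfl⟩ := coeff_coordChange g hn hβ hβ0 he
      (IsManifold.chart_mem_maximalAtlas (e.symm u)) hu (mem_chart_source (Coord n) _) h
      (hcd (e.symm u))
    exact h
  have hcoeff : ∀ e ∈ IsManifold.maximalAtlas (𝓡 n) ∞ M, ∀ x ∈ e.source,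
      c x = coeffC (metricCoeff g e) (formCoeff β e) (fun u => formNorm g β (e.symm u)) (e x) ∧
      d x = coeffD (metricCoeff g e) (formCoeff β e) (fun u => formNorm g β (e.symm u)) (e x) := by
    intro e he x hx
    have h := (isLocalModel g hβ hβ0 he).eq_coeff hn (e.map_source hx)
      (hS e he _ (e.map_source hx))
    rwa [e.left_inv hx] at h
  have hsmooth : ∀ {f : M → ℝ} (k : OpenPartialHomeomorph M (Coord n) → Coord n → ℝ),
      (∀ e ∈ IsManifold.maximalAtlas (𝓡 n) ∞ M, ContDiffOn ℝ ∞ (k e) e.target ∧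
        ∀ x ∈ e.source, f x = k e (e x)) → ContMDiff (𝓡 n) 𝓘(ℝ) ∞ f := by
    intro f k hk x
    have hx := mem_chart_source (Coord n) x
    have he := IsManifold.chart_mem_maximalAtlas (I := 𝓡 n) (n := ∞) x
    obtain ⟨h1, h2⟩ := hk _ he
    have h3 : ContMDiffAt 𝓘(ℝ, Coord n) 𝓘(ℝ) ∞ (k (chartAt (Coord n) x))
        (chartAt (Coord n) x x) :=
      (h1.contDiffAt ((chartAt (Coord n) x).open_target.mem_nhds
        ((chartAt (Coord n) x).map_source hx))).contMDiffAt
    refine (h3.comp x (contMDiffAt_of_mem_maximalAtlas he hx)).congr_of_eventuallyEq ?_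
    filter_upwards [(chartAt (Coord n) x).open_source.mem_nhds hx] with z hz
    exact h2 z hz
  exact ⟨c, d,
    hsmooth _ fun e he => ⟨(isLocalModel g hβ hβ0 he).contDiffOn_coeffC,
      fun x hx => (hcoeff e he x hx).1⟩,
    hsmooth _ fun e he => ⟨(isLocalModel g hβ hβ0 he).contDiffOn_coeffD,
      fun x hx => (hcoeff e he x hx).2⟩, hS⟩

theorem isDouglas_of_structureEquations (hn : 3 ≤ n) (hβ : IsSmoothForm β)
    (hβ0 : ∀ x, β x ≠ 0) {c d : M → ℝ}
    (hS : ∀ e ∈ IsManifold.maximalAtlas (𝓡 n) ∞ M, ∀ u ∈ e.target,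
      StructureEquations (metricCoeff g e) (formCoeff β e) (formNorm g β (e.symm u))
        (c (e.symm u)) (d (e.symm u)) u) :
    IsDouglas (singularSquareMetric g β) := by
  intro e he u hu y hy hdet i j k l
  exact (isLocalModel g hβ hβ0 he).douglasCurvature_eq_zero hn hu hy hdet (hS e he u hu) i j k l

end

end SingularSquare
end

theorem theorem1p1 (n : ℕ) (hn : 3 ≤ n) (M : Type*) [TopologicalSpace M]
    [ChartedSpace (SingularSquare.Coord n) M] [IsManifold (𝓡 n) ∞ M]
    (g : Bundle.ContMDiffRiemannianMetric (𝓡 n) ∞ (SingularSquare.Coord n)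
      (fun x : M => TangentSpace (𝓡 n) x))
    (β : (x : M) → TangentSpace (𝓡 n) x →L[ℝ] ℝ)
    (hβ : SingularSquare.IsSmoothForm β) (hβ0 : ∀ x, β x ≠ 0) :
    SingularSquare.IsDouglas (SingularSquare.singularSquareMetric g β) ↔
      ∃ c d : M → ℝ, ContMDiff (𝓡 n) 𝓘(ℝ) ∞ c ∧ ContMDiff (𝓡 n) 𝓘(ℝ) ∞ d ∧
        ∀ e ∈ IsManifold.maximalAtlas (𝓡 n) ∞ M, ∀ u ∈ e.target,
          SingularSquare.StructureEquations (SingularSquare.metricCoeff g e)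
            (SingularSquare.formCoeff β e) (SingularSquare.formNorm g β (e.symm u))
            (c (e.symm u)) (d (e.symm u)) u :=
  ⟨fun h => h.exists_structureEquations g hn hβ hβ0, fun ⟨_, _, _, _, hS⟩ =>
    SingularSquare.isDouglas_of_structureEquations g hn hβ hβ0 hS⟩
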